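/- **Theorem (local triviality of truncation maps on arc spaces, Denef–Loeser).** Let $k$ be a field of characteristic $0$ and let $X=V(f_1,\dots,f_p)\subseteq\mathbb A^n_k$, $f_i\in k[x_1,\dots,x_n]$, be of pure dimension $d$ (every minimal prime of $(f_1,\dots,f_p)$ has coordinate ring of Krull dimension $d$). Write $\mathcal A=k[[t]]$, $\mathfrak m=(t)$ and $$X_\infty=\{a\in\mathcal A^n:\ f_1(a)=\dots=f_p(a)=0\},$$ and for $q\in\mathbb N$ let $\pi_q$ send a vector of power series to its coefficients up to order $q$, so that $\pi_q(X_\infty)\subseteq (k^n)^{q+1}$. Let $I$ be the ideal of $\operatorname{Sing}X$ generated by $f_1,\dots,f_p$ and all $(n-d)\times(n-d)$-minors of the Jacobian matrix $(\partial f_i/\partial x_j)$. For $e\in\mathbb N$ put $$\mathcal A_e(X)=\{a\in X_\infty:\ \min_{g\in I}\operatorname{ord}_t g(a)\le e\}.$$ A map between sets of vectors of power series and/or jets is *textile* if each coefficient of the image is a polynomial in the coefficients of the argument. A *regular family of textile maps* over $S\subseteq k^N$ is a map on a product $S\times Y$ each of whose coefficients is, Zariski-locally on $S$, a polynomial in the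 coordinates of $s\in S$ and the coefficients of $y\in Y$, divided by a polynomial in the coordinates of $s$ not vanishing there. Then for every $e\in\mathbb N$: 1. The map $\pi_e:X_\infty\to\pi_e(X_\infty)$ is a piecewise trivial fibration over $\pi_e(\mathcal A_e(X))$ with fibre $\mathfrak m^{e+1}\cdot\mathcal A^d$. That is, $\pi_e(\mathcal A_e(X))$ is a finite disjoint union of Zariski locally closed subsets $S\subseteq (k^n)^{e+1}$, and for each $S$ there is a bijection $$\varphi:\ X_\infty\cap\pi_e^{-1}(S)\ \longrightarrow\ S\times(\mathfrak m^{e+1}\cdot\mathcal A^d),\qquad \mathrm{proj}_1\circ\varphi=\pi_e,$$ such that $\varphi$ is textile and $\varphi^{-1}$ is a regular family of textile maps over $S$. Moreover $\varphi$ is compatible with all truncations: for every $q\ge e$ there is a bijection $\varphi_q:\pi_q(X_\infty\cap\pi_e^{-1}(S))\to S\times\pi_q(\mathfrak m^{e+1}\cdot\mathcal A^d)$ with $\varphi_q\circ\pi_q=(\mathrm{id}_S\times\pi_q)\circ\varphi$, and $\varphi_q$ and $\varphi_q^{-1}$ are regular (coordinatewise Zariski-locally quotients of polynomials). 2. For every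 $q\ge e$ the truncation map $\theta_q:\pi_{q+1}(X_\infty)\to\pi_q(X_\infty)$ is a piecewise trivial fibration over $\pi_q(\mathcal A_e(X))$ with fibre $\mathbb A^d_k=k^d$: there is a finite partition of $\pi_q(\mathcal A_e(X))$ into Zariski locally closed subsets $T$ of $(k^n)^{q+1}$ such that $\theta_q^{-1}(T)$ is Zariski locally closed in $(k^n)^{q+2}$ and there is a bijection $\theta_q^{-1}(T)\to T\times k^d$ over $T$ that is regular with regular inverse. -/

import Mathlib

namespace ArcSpace

variable {k : Type*} [Field k]

/-! ### Vectors of power series, jets and truncation -/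

/-- The space `𝓐ⁿ` of `n`-tuples of power series `k[[t]]`. -/
abbrev Series (k : Type*) [Field k] (n : ℕ) : Type _ := Fin n → PowerSeries k

/-- The space `(𝓐 / 𝔪^(q+1))ⁿ ≅ k^(n(q+1))` of coefficient vectors up to order `q`;
the coordinate `(i, j)` is the `j`-th coefficient of the `i`-th component. -/
abbrev Jet (k : Type*) (n q : ℕ) : Type _ := Fin n × Fin (q + 1) → k

/-- The coefficients of a vector of power series, as a point of the infinite affine space
with coordinates indexed by `Fin n × ℕ`. -/
noncomputable def coeffs {n : ℕ} (a : Series k n) : Fin n × ℕ → k :=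
  fun ij => PowerSeries.coeff ij.2 (a ij.1)

/-- The truncation `π_q`: the coefficients up to order `q`. -/
noncomputable def trunc {n : ℕ} (q : ℕ) (a : Series k n) : Jet k n q :=
  fun ij => PowerSeries.coeff (ij.2 : ℕ) (a ij.1)

/-- The truncation from jets of order `q + 1` to jets of order `q`. -/
def jetTrunc {n : ℕ} (q : ℕ) (a : Jet k n (q + 1)) : Jet k n q :=
  fun ij => a (ij.1, ij.2.castSucc)

/-- `𝔪^r · 𝓐^d`: all components have order at least `r`. -/
def mPow (k : Type*) [Field k] (d r : ℕ) : Set (Series k d) :=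
  {c | ∀ i, c i ∈ (Ideal.span {(PowerSeries.X : PowerSeries k)}) ^ r}

/-! ### The affine variety, its singular ideal and its arcs -/

/-- The variety `V(f₁, …, f_p)` is of pure dimension `d`: every irreducible component,
that is, every minimal prime of `(f₁, …, f_p)`, has dimension `d`. -/
def IsPureDim {n p : ℕ} (f : Fin p → MvPolynomial (Fin n) k) (d : ℕ) : Prop :=
  ∀ P ∈ (Ideal.span (Set.range f)).minimalPrimes,
    ringKrullDim (MvPolynomial (Fin n) k ⧸ P) = (d : WithBot ℕ∞)

/-- The Jacobian matrix `(∂ f_i / ∂ x_j)`. -/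
noncomputable def jacobian {n p : ℕ} (f : Fin p → MvPolynomial (Fin n) k) :
    Matrix (Fin p) (Fin n) (MvPolynomial (Fin n) k) :=
  Matrix.of fun i j => MvPolynomial.pderiv j (f i)

/-- The ideal of the singular locus of `V(f₁, …, f_p) ⊆ 𝔸ⁿ`, of pure dimension `d`:
generated by the `f_i` and the minors of size `n - d` of the Jacobian matrix. (One has `d ≤ n`
as soon as the variety is non-empty. Rows and columns may be repeated or permuted here, which
adds to the minors only zeros and sign changes.) -/
noncomputable def singIdeal {n p : ℕ} (f : Fin p → MvPolynomial (Fin n) k) (d : ℕ) :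
    Ideal (MvPolynomial (Fin n) k) :=
  Ideal.span (Set.range f ∪
    {θ | ∃ (r : Fin (n - d) → Fin p) (s : Fin (n - d) → Fin n),
      θ = ((jacobian f).submatrix r s).det})

/-- The arc space `X_∞ ⊆ k[[t]]ⁿ` of `X = V(f₁, …, f_p)`. -/
def arcs {n p : ℕ} (f : Fin p → MvPolynomial (Fin n) k) : Set (Series k n) :=
  {a | ∀ i, MvPolynomial.aeval a (f i) = 0}

/-- The order of `a` with respect to the ideal `I`: the minimum of the orders of the power
series `g(a)`, `g ∈ I`. -/
noncomputable def ordIdeal {n : ℕ} (I : Ideal (MvPolynomial (Fin n) k)) (a : Series k n) : ℕ∞ :=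
  ⨅ g ∈ I, (MvPolynomial.aeval a g : PowerSeries k).order

/-- `𝓐_e(X)`: the arcs of `X` that have order at most `e` with respect to the ideal of the
singular locus. -/
def arcsOrdLE {n p : ℕ} (f : Fin p → MvPolynomial (Fin n) k) (d e : ℕ) : Set (Series k n) :=
  {a | a ∈ arcs f ∧ ordIdeal (singIdeal f d) a ≤ (e : ℕ∞)}

/-- `π_e⁻¹(S)`: the arcs of `X` whose truncation to order `e` lies in `S`. -/
def arcsOver {n p : ℕ} (f : Fin p → MvPolynomial (Fin n) k) (e : ℕ) (S : Set (Jet k n e)) :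
    Set (Series k n) :=
  {a | a ∈ arcs f ∧ trunc e a ∈ S}

/-! ### Zariski locally closed sets, textile maps and regular maps -/

/-- A locally closed subset of `k^ι` for the Zariski topology. -/
def IsZariskiLocallyClosed {ι : Type*} (S : Set (ι → k)) : Prop :=
  ∃ I J : Ideal (MvPolynomial ι k),
    S = MvPolynomial.zeroLocus k I \ MvPolynomial.zeroLocus k J

/-- Coordinates on a product of two sets with coordinates. -/
def prodCoord {α β ι κ : Type*} (u : α → ι → k) (v : β → κ → k) (x : α × β) : ι ⊕ κ → k :=
  Sum.elim (u x.1) (v x.2)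

/-- A map `g` between sets `α`, `β` with coordinates `u`, `v` is textile if each coordinate of
`g x` is a polynomial in the (possibly infinitely many) coordinates of `x`. -/
def IsTextile {α β ι κ : Type*} (u : α → ι → k) (v : β → κ → k) (g : α → β) : Prop :=
  ∀ j, ∃ P : MvPolynomial ι k, ∀ x, v (g x) j = MvPolynomial.eval (u x) P

/-- A map `g` between sets `α`, `β` with coordinates `u`, `v` is regular if each coordinate of
`g` is, Zariski-locally on `α`, a quotient of polynomials in the coordinates. -/
def IsRegularMap {α β ι κ : Type*} (u : α → ι → k) (v : β → κ → k) (g : α → β) : Prop :=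
  ∀ j x₀, ∃ h l : MvPolynomial ι k, MvPolynomial.eval (u x₀) l ≠ 0 ∧
    ∀ x, MvPolynomial.eval (u x) l ≠ 0 →
      v (g x) j = MvPolynomial.eval (u x) h / MvPolynomial.eval (u x) l

/-- A map `g : S × Y → β`, where `S`, `Y`, `β` have coordinates `u`, `w`, `v`, is a regular
family of textile maps over the parameter space `S`: Zariski-locally on `S`, each coordinate of
`g (s, y)` is a polynomial in the coordinates of `s` and `y` divided by a polynomial in `s`. In
particular `g (s, ·)` is textile for every `s`. -/
def IsRegularFamily {S Y β ι μ κ : Type*} (u : S → ι → k) (w : Y → μ → k) (v : β → κ → k)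
    (g : S × Y → β) : Prop :=
  ∀ j s₀, ∃ (h : MvPolynomial (ι ⊕ μ) k) (l : MvPolynomial ι k),
    MvPolynomial.eval (u s₀) l ≠ 0 ∧
    ∀ s y, MvPolynomial.eval (u s) l ≠ 0 →
      v (g (s, y)) j =
        MvPolynomial.eval (prodCoord u w (s, y)) h / MvPolynomial.eval (u s) l

/-- The map `θ : A → k^κ`, `A ⊆ k^ι`, is a piecewise trivial fibration over `C ⊆ k^κ` with fibre
the affine space `k^d`: there is a finite partition of `C` into Zariski locally closed sets `T`
such that `A ∩ θ⁻¹(T)` is locally closed and isomorphic to `T × k^d` over `T`. -/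
def IsPiecewiseTrivial {ι κ : Type*} (A : Set (ι → k)) (θ : (ι → k) → (κ → k))
    (C : Set (κ → k)) (d : ℕ) : Prop :=
  ∃ (N : ℕ) (T : Fin N → Set (κ → k)),
    (⋃ i, T i) = C ∧ Pairwise (Function.onFun Disjoint T) ∧
    ∀ i, IsZariskiLocallyClosed (T i) ∧ IsZariskiLocallyClosed (A ∩ θ ⁻¹' T i) ∧
      ∃ ψ : ↥(A ∩ θ ⁻¹' T i) ≃ ↥(T i) × (Fin d → k),
        (∀ x, ((ψ x).1 : κ → k) = θ x) ∧
        IsRegularMap Subtype.val (prodCoord Subtype.val id) ψ ∧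
        IsRegularMap (prodCoord Subtype.val id) Subtype.val ψ.symm

/-- Coordinates on a set of vectors of power series: the coefficients. -/
noncomputable def seriesCoord {n : ℕ} (Y : Set (Series k n)) (y : Y) : Fin n × ℕ → k :=
  coeffs (y : Series k n)

end ArcSpace

open ArcSpace

namespace ArcSpace
open MvPolynomial

/-! Put r = n - d. Let det M be an r × r-minor of the Jacobian matrix, with rows F and columns C,
which has order m ≤ e at an arc a, while the minors with one column exchanged have order at least m.
Expand F(a + t^(e+1) z) to second order and multiply by adj M. The linear part becomes t^(e+1+m)
times (unit · z_C + a combination of the other z_j), and the remainder carries t^(2(e+1)). Since m ≤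
e, dividing by t^(e+1+m) leaves a contracting equation for z_C in which the other d coordinates are
free. So the arcs of V(F) with the e-jet of a are parametrized by 𝔪^(e+1)𝓐^d
(`IsAdapted.exists_solution`, `IsAdapted.dvd_sub_of_free`). Solving the same equation over a ring of
functions in which the leading coefficient of the minor is invertible yields regular dependence on
parameters (`exists_regular_solution`).

V(F) may have components outside X, and this is where pure dimension and characteristic 0 enter. On
each component of X where det M does not vanish, the differentials of the free coordinates form a
basis of the differentials of the function field, so the gradient of any function vanishing on X is
a combination of the gradients of F (`det_mul_mem_radical`). Join an arc a of X to an arc b of V(F)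
with the same e-jet by a family β_s in V(F). For g vanishing on X, the gradient relation bounds the
s-derivative of g(β_s), and induction shows that every power of s divides g(β_s). Hence b lies in X
(`aeval_eq_zero_of_mem_radical`).

The strata S collect the e-jets of arcs according to the lexicographically first pair (exponent,
minor) with non-zero coefficient. `exists_isChart_stratum` gives each of them a chart Φ. Since the
q-jet of Φ(s, y) depends only on s and the q-jet of y, the statements about jets follow from the
same chart. -/

/-! ### Differentials of function fields and the gradient relation -/

lemma ringKrullDim_le_of_isIntegral {A B : Type*} [CommRing A] [CommRing B] [Algebra A B]
    [Algebra.IsIntegral A B] : ringKrullDim B ≤ ringKrullDim A := by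
  refine Order.krullDim_le_of_strictMono (PrimeSpectrum.comap (algebraMap A B)) fun P Q h => ?_
  exact Ideal.IsIntegral.comap_lt_comap (R := A) (I := P.asIdeal) (J := Q.asIdeal) h

/-- The module of differentials of the function field of an affine variety over a field of
characteristic zero has rank at least the dimension of the variety. -/
lemma le_finrank_kaehlerDifferential {k A K : Type*} [Field k] [CharZero k] [CommRing A]
    [IsDomain A] [Algebra k A] [Algebra.FiniteType k A] [Field K] [Algebra k K] [Algebra A K]
    [IsScalarTower k A K] [IsFractionRing A K] {d : ℕ} (hd : ringKrullDim A = d) :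
    d ≤ Module.finrank K (Ω[K⁄k]) := by
  -- Noether normalization. In characteristic 0, `K` is separable algebraic over the field of
  -- fractions of the polynomial ring, hence formally étale over that ring. So the `m` differentials
  -- of the variables form a basis, and integrality gives `d ≤ m`.
  obtain ⟨m, g, hg, hint⟩ := exists_integral_inj_algHom_of_fg k A
  let : Algebra (MvPolynomial (Fin m) k) A := g.toRingHom.toAlgebra
  have : IsScalarTower k (MvPolynomial (Fin m) k) A := IsScalarTower.of_algebraMap_eq' (by
    ext x; exact (g.commutes x).symm)
  have : Algebra.IsIntegral (MvPolynomial (Fin m) k) A := ⟨hint⟩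
  let : Algebra (MvPolynomial (Fin m) k) K :=
    ((algebraMap A K).comp (algebraMap (MvPolynomial (Fin m) k) A)).toAlgebra
  have : IsScalarTower (MvPolynomial (Fin m) k) A K := IsScalarTower.of_algebraMap_eq' rfl
  have : IsScalarTower k (MvPolynomial (Fin m) k) K := IsScalarTower.of_algebraMap_eq' (by
    rw [IsScalarTower.algebraMap_eq k A K, IsScalarTower.algebraMap_eq k (MvPolynomial (Fin m) k) A,
      IsScalarTower.algebraMap_eq (MvPolynomial (Fin m) k) A K, RingHom.comp_assoc])
  have hinj : Function.Injective (algebraMap (MvPolynomial (Fin m) k) K) :=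
    (IsFractionRing.injective A K).comp hg
  have : FaithfulSMul (MvPolynomial (Fin m) k) K :=
    (faithfulSMul_iff_algebraMap_injective _ _).2 hinj
  let L := FractionRing (MvPolynomial (Fin m) k)
  let : Algebra L K := FractionRing.liftAlgebra _ K
  have : IsScalarTower (MvPolynomial (Fin m) k) L K := FractionRing.isScalarTower_liftAlgebra _ _
  have : Algebra.IsAlgebraic (MvPolynomial (Fin m) k) A := inferInstance
  have : Algebra.IsAlgebraic A K :=
    (IsFractionRing.comap_isAlgebraic_iff (A := A) (K := K) (C := K)).2 inferInstance
  have : FaithfulSMul (MvPolynomial (Fin m) k) A :=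
    (faithfulSMul_iff_algebraMap_injective _ _).2 hg
  have : Algebra.IsAlgebraic (MvPolynomial (Fin m) k) K :=
    Algebra.IsAlgebraic.trans (MvPolynomial (Fin m) k) A K
  have : Algebra.IsAlgebraic L K :=
    (IsFractionRing.comap_isAlgebraic_iff (A := MvPolynomial (Fin m) k) (K := L) (C := K)).1 this
  have : CharZero L := charZero_of_injective_algebraMap
    (R := k) (algebraMap k L).injective
  have : Algebra.FormallyEtale L K := Algebra.FormallyEtale.of_isSeparable _ _
  have : Algebra.FormallyEtale (MvPolynomial (Fin m) k) L :=
    .of_isLocalization (nonZeroDivisors _)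
  have : Algebra.FormallyEtale (MvPolynomial (Fin m) k) K := .comp _ L K
  have e := KaehlerDifferential.tensorKaehlerEquivOfFormallyEtale k (MvPolynomial (Fin m) k) K
  have b := KaehlerDifferential.mvPolynomialBasis k (Fin m)
  rw [Module.finrank_eq_card_basis ((b.baseChange K).map e), Fintype.card_fin]
  have h1 := ringKrullDim_le_of_isIntegral (A := MvPolynomial (Fin m) k) (B := A)
  rw [hd] at h1
  simpa using h1

lemma derivation_aeval {k B M : Type*} [CommRing k] [CommRing B] [Algebra k B] [AddCommGroup M]
    [Module B M] [Module k M] [IsScalarTower k B M] {n : ℕ} (D : Derivation k B M)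
    (x : Fin n → B) (p : MvPolynomial (Fin n) k) :
    D (aeval x p) = ∑ j, aeval x (pderiv j p) • D (x j) := by
  induction p using MvPolynomial.induction_on with
  | C a => simp
  | add p q hp hq => simp [hp, hq, add_smul, Finset.sum_add_distrib]
  | mul_X p i hp =>
    simp only [map_mul, aeval_X, Derivation.leibniz, hp, pderiv_X, map_add, smul_eq_mul,
      add_smul, Finset.sum_add_distrib, Finset.smul_sum, mul_smul]
    congr 1
    rw [Finset.sum_eq_single i]
    · simp
    · intro j _ hj
      simp [hj.symm]
    · simp

/-- A linear relation between spanning vectors is a consequence of given relations with an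
invertible minor, if the dimension is at least the number of the remaining vectors. -/
lemma det_mul_eq_of_relations {K V : Type*} [Field K] [AddCommGroup V] [Module K V] {n r d : ℕ}
    (σ : Fin r ⊕ Fin d ≃ Fin n) (v : Fin n → V) (hv : Submodule.span K (Set.range v) = ⊤)
    (hd : d ≤ Module.finrank K V) (J : Matrix (Fin r) (Fin n) K) (hJ : ∀ i, ∑ j, J i j • v j = 0)
    (hdet : (Matrix.of fun i j => J i (σ (Sum.inl j))).det ≠ 0) (γ : Fin n → K)
    (hγ : ∑ j, γ j • v j = 0) (o : Fin d) :
    (Matrix.of fun i j => J i (σ (Sum.inl j))).det * γ (σ (Sum.inr o)) =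
      ∑ i, ∑ l, γ (σ (Sum.inl i)) *
        (Matrix.of fun i j => J i (σ (Sum.inl j))).adjugate i l * J l (σ (Sum.inr o)) := by
  set M : Matrix (Fin r) (Fin r) K := Matrix.of fun i j => J i (σ (Sum.inl j)) with hM
  -- Cramer elimination: the given relations, multiplied by the adjugate, express the first `r`
  -- vectors by the last `d`. These therefore span, and by the dimension bound they form a basis.
  have key : ∀ i, M.det • v (σ (Sum.inl i)) =
      -∑ o, (∑ l, M.adjugate i l * J l (σ (Sum.inr o))) • v (σ (Sum.inr o)) := by
    intro i
    have h0 : ∀ l, ∑ c, M l c • v (σ (Sum.inl c)) =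
        -∑ o, J l (σ (Sum.inr o)) • v (σ (Sum.inr o)) := by
      intro l
      have := hJ l
      rw [← Equiv.sum_comp σ, Fintype.sum_sum_type] at this
      exact eq_neg_of_add_eq_zero_left this
    have h1 : ∑ l, M.adjugate i l • ∑ c, M l c • v (σ (Sum.inl c)) =
        M.det • v (σ (Sum.inl i)) := by
      simp_rw [Finset.smul_sum, smul_smul]
      rw [Finset.sum_comm]
      simp_rw [← Finset.sum_smul, ← Matrix.mul_apply, Matrix.adjugate_mul, Matrix.smul_apply,
        Matrix.one_apply, smul_eq_mul, mul_ite, mul_one, mul_zero, ite_smul, zero_smul]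
      simp
    rw [← h1]
    simp_rw [h0, smul_neg, Finset.sum_neg_distrib, Finset.smul_sum, smul_smul, Finset.sum_smul]
    rw [Finset.sum_comm]
  have hspan : ⊤ ≤ Submodule.span K (Set.range fun o => v (σ (Sum.inr o))) := by
    rw [← hv, Submodule.span_le]
    rintro _ ⟨j, rfl⟩
    obtain ⟨s, rfl⟩ := σ.surjective j
    rcases s with i | o
    · have := key i
      rw [← eq_inv_smul_iff₀ hdet] at this
      rw [SetLike.mem_coe, this]
      exact Submodule.smul_mem _ _ (Submodule.neg_mem _ (Submodule.sum_mem _ fun o _ =>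
        Submodule.smul_mem _ _ (Submodule.subset_span ⟨o, rfl⟩)))
    · exact Submodule.subset_span ⟨o, rfl⟩
  have hfin : Module.finrank K V = d := by
    refine le_antisymm ?_ hd
    have := finrank_range_le_card (R := K) fun o => v (σ (Sum.inr o))
    rwa [Set.finrank, top_le_iff.1 hspan, finrank_top, Fintype.card_fin] at this
  have hli := linearIndependent_of_top_le_span_of_card_eq_finrank hspan (by simp [hfin])
  rw [Fintype.linearIndependent_iff] at hli
  have := hli (fun o => M.det * γ (σ (Sum.inr o)) -
    ∑ i, ∑ l, γ (σ (Sum.inl i)) * M.adjugate i l * J l (σ (Sum.inr o))) ?_ o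
  · exact sub_eq_zero.1 this
  · have h2 : ∑ j, γ (σ (Sum.inl j)) • M.det • v (σ (Sum.inl j)) +
        ∑ o, (M.det * γ (σ (Sum.inr o))) • v (σ (Sum.inr o)) = 0 := by
      rw [← Equiv.sum_comp σ, Fintype.sum_sum_type] at hγ
      rw [← smul_zero M.det, ← hγ, smul_add, Finset.smul_sum, Finset.smul_sum]
      simp_rw [smul_smul, mul_comm]
    simp_rw [key, smul_neg, Finset.smul_sum, smul_smul, Finset.sum_neg_distrib] at h2
    rw [Finset.sum_comm, ← sub_eq_neg_add, ← Finset.sum_sub_distrib] at h2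
    rw [← h2]
    refine Finset.sum_congr rfl fun o _ => ?_
    rw [sub_smul, Finset.sum_smul]
    simp_rw [Finset.mul_sum, mul_assoc]

/-- Along a scheme of pure dimension `d = n - r`, the gradient of a function vanishing on it is,
where an `r × r`-minor of the Jacobian matrix of `r` such functions does not vanish, a combination
of the gradients of these functions. -/
lemma det_mul_mem_radical {k : Type*} [Field k] [CharZero k] {n r d : ℕ}
    {I : Ideal (MvPolynomial (Fin n) k)}
    (hI : ∀ P ∈ I.minimalPrimes, ringKrullDim (MvPolynomial (Fin n) k ⧸ P) = (d : WithBot ℕ∞))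
    (σ : Fin r ⊕ Fin d ≃ Fin n) (F : Fin r → MvPolynomial (Fin n) k) (hF : ∀ i, F i ∈ I.radical)
    (g : MvPolynomial (Fin n) k) (hg : g ∈ I.radical) (o : Fin d)
    {M : Matrix (Fin r) (Fin r) (MvPolynomial (Fin n) k)}
    (hM : M = Matrix.of fun i j => pderiv (σ (Sum.inl j)) (F i)) :
    M.det * (M.det * pderiv (σ (Sum.inr o)) g - ∑ i, ∑ l, pderiv (σ (Sum.inl i)) g *
      M.adjugate i l * pderiv (σ (Sum.inr o)) (F l)) ∈ I.radical := by
  rw [← Ideal.sInf_minimalPrimes, Ideal.mem_sInf]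
  intro Q hQ
  have hQp : Q.IsPrime := hQ.1.1
  have hrad : I.radical ≤ Q := hQp.radical_le_iff.2 hQ.1.2
  let A := MvPolynomial (Fin n) k ⧸ Q
  let K := FractionRing A
  let π : MvPolynomial (Fin n) k →ₐ[k] K := (IsScalarTower.toAlgHom k A K).comp
    (Ideal.Quotient.mkₐ k Q)
  have hπ : ∀ p, π p = 0 ↔ p ∈ Q := by
    intro p
    change algebraMap A K (Ideal.Quotient.mk Q p) = 0 ↔ _
    rw [IsFractionRing.to_map_eq_zero_iff, Ideal.Quotient.eq_zero_iff_mem]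
  have hae : ∀ p, aeval (fun j => π (X j)) p = π p := fun p => by
    rw [← comp_aeval_apply, aeval_X_left_apply]
  have hD : ∀ p ∈ Q, ∑ j, π (pderiv j p) • KaehlerDifferential.D k K (π (X j)) = 0 := by
    intro p hp
    have := derivation_aeval (KaehlerDifferential.D k K) (fun j => π (X j)) p
    simp_rw [hae] at this
    rw [← this, (hπ p).2 hp, map_zero]
  have hspan : Submodule.span K (Set.range fun j => KaehlerDifferential.D k K (π (X j))) = ⊤ := by
    rw [eq_top_iff, ← KaehlerDifferential.span_range_map_derivation_of_isLocalization k A K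
      (nonZeroDivisors A), Submodule.span_le]
    rintro _ ⟨a, rfl⟩
    obtain ⟨p, rfl⟩ := Ideal.Quotient.mk_surjective a
    have := derivation_aeval (KaehlerDifferential.D k K) (fun j => π (X j)) p
    simp_rw [hae] at this
    rw [Function.comp_apply, KaehlerDifferential.map_D]
    change KaehlerDifferential.D k K (π p) ∈ _
    rw [this]
    exact Submodule.sum_mem _ fun j _ => Submodule.smul_mem _ _ (Submodule.subset_span ⟨j, rfl⟩)
  -- The outer factor `M.det` disposes of the components on which the minor vanishes.
  by_cases hdet : M.det ∈ Q
  · exact Q.mul_mem_right _ hdet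
  refine Q.mul_mem_left _ ((hπ _).1 ?_)
  have hMπ : (Matrix.of fun i j => π (pderiv (σ (Sum.inl j)) (F i))) = M.map π := by
    ext i j; simp [hM]
  have hdetπ : (M.map π).det = π M.det := (AlgHom.map_det π M).symm
  have hadj : ∀ i l, (M.map π).adjugate i l = π (M.adjugate i l) := by
    intro i l
    have := AlgHom.map_adjugate π M
    exact (congr_fun (congr_fun this i) l).symm
  have := det_mul_eq_of_relations σ (fun j => KaehlerDifferential.D k K (π (X j))) hspan
    (le_finrank_kaehlerDifferential (k := k) (A := A) (K := K) (hI Q hQ))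
    (Matrix.of fun i j => π (pderiv j (F i))) (fun i => hD _ (hrad (hF i)))
    (by
      change (Matrix.of fun i j => π (pderiv (σ (Sum.inl j)) (F i))).det ≠ 0
      rw [hMπ, hdetπ, ne_eq, hπ]
      exact hdet)
    (fun j => π (pderiv j g)) (hD _ (hrad hg)) o
  change (Matrix.of fun i j => π (pderiv (σ (Sum.inl j)) (F i))).det * _ = ∑ i, ∑ l, _ *
    (Matrix.of fun i j => π (pderiv (σ (Sum.inl j)) (F i))).adjugate i l * _ at this
  rw [hMπ, hdetπ] at this
  simp_rw [hadj] at this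
  simp only [map_sub, map_mul, map_sum, this, Matrix.of_apply, sub_self]

/-! ### Taylor expansion and t-adic fixed points -/

lemma aeval_sub_mem {k B : Type*} [CommRing k] [CommRing B] [Algebra k B] {n : ℕ} (I : Ideal B)
    {a b : Fin n → B} (h : ∀ j, a j - b j ∈ I) (p : MvPolynomial (Fin n) k) :
    aeval a p - aeval b p ∈ I := by
  rw [← Ideal.Quotient.eq]
  have : (fun j => Ideal.Quotient.mkₐ k I (a j)) = fun j => Ideal.Quotient.mkₐ k I (b j) := by
    ext j
    exact Ideal.Quotient.eq.2 (h j)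
  change Ideal.Quotient.mkₐ k I _ = Ideal.Quotient.mkₐ k I _
  rw [comp_aeval_apply, comp_aeval_apply, this]

lemma dvd_aeval_sub {k B : Type*} [CommRing k] [CommRing B] [Algebra k B] {n : ℕ} {s : B}
    {a b : Fin n → B} (h : ∀ j, s ∣ a j - b j) (p : MvPolynomial (Fin n) k) :
    s ∣ aeval a p - aeval b p := by
  simp_rw [← Ideal.mem_span_singleton] at h ⊢
  exact aeval_sub_mem _ h p

/-- Taylor expansion up to order two. -/
lemma exists_taylor {k B : Type*} [CommRing k] [CommRing B] [Algebra k B] {n : ℕ} (a : Fin n → B)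
    (s : B) (p : MvPolynomial (Fin n) k) :
    ∃ Q : MvPolynomial (Fin n) B, ∀ z : Fin n → B, aeval (fun j => a j + s * z j) p =
      aeval a p + s * ∑ j, aeval a (pderiv j p) * z j + s ^ 2 * aeval z Q := by
  induction p using MvPolynomial.induction_on with
  | C c => exact ⟨0, fun z => by simp⟩
  | add p q hp hq =>
    obtain ⟨P, hP⟩ := hp
    obtain ⟨Q, hQ⟩ := hq
    refine ⟨P + Q, fun z => ?_⟩
    simp only [map_add, hP, hQ, add_mul, Finset.sum_add_distrib]
    ring
  | mul_X p i hp =>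
    obtain ⟨Q, hQ⟩ := hp
    -- The terms with factor s² in the product of the expansion of `p` with `a i + s * z i`. The
    -- remainder is a polynomial in `z`, so it respects congruences between different `z`.
    refine ⟨Q * C (a i) + (∑ j, C (aeval a (pderiv j p)) * X j) * X i + C s * Q * X i,
      fun z => ?_⟩
    have : ∑ j, aeval a (pderiv j (p * X i)) * z j =
        (∑ j, aeval a (pderiv j p) * z j) * a i + aeval a p * z i := by
      simp only [Derivation.leibniz, pderiv_X, smul_eq_mul, map_add, map_mul, aeval_X, add_mul,
        Finset.sum_add_distrib, Finset.sum_mul]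
      rw [add_comm]
      congr 1
      · exact Finset.sum_congr rfl fun j _ => by ring
      · rw [Finset.sum_eq_single i]
        · simp
        · intro j _ hj
          simp [hj.symm]
        · simp
    rw [this]
    simp only [map_mul, map_add, map_sum, aeval_X, hQ, aeval_C, Algebra.algebraMap_self,
      RingHom.id_apply]
    ring

lemma eq_of_forall_X_pow_dvd_sub {R : Type*} [CommRing R] {φ ψ : PowerSeries R}
    (h : ∀ m : ℕ, (PowerSeries.X : PowerSeries R) ^ m ∣ φ - ψ) : φ = ψ := by
  ext m
  have := PowerSeries.X_pow_dvd_iff.1 (h (m + 1)) m m.lt_succ_self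
  rwa [map_sub, sub_eq_zero] at this

/-- A map between vectors of power series which increases the order of differences has a fixed
point. -/
lemma exists_fixed_point_of_contracting {R ι : Type*} [CommRing R]
    (G : (ι → PowerSeries R) → ι → PowerSeries R)
    (hG : ∀ (m : ℕ) (c c' : ι → PowerSeries R), (∀ i, PowerSeries.X ^ m ∣ c i - c' i) →
      ∀ i, PowerSeries.X ^ (m + 1) ∣ G c i - G c' i) :
    ∃ c, G c = c := by
  -- Iteration from 0: the coefficient of order `j` no longer changes after step `j + 1`.
  let s : ℕ → ι → PowerSeries R := fun m => G^[m] 0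
  have hs : ∀ m, s (m + 1) = G (s m) := fun m => Function.iterate_succ_apply' G m 0
  have h1 : ∀ m i, PowerSeries.X ^ m ∣ s (m + 1) i - s m i := by
    intro m
    induction m with
    | zero => simp
    | succ m ih =>
      intro i
      rw [hs (m + 1), hs m]
      exact hG m _ _ (by rw [← hs]; exact ih) i
  have h2 : ∀ j m, j < m → ∀ i,
      PowerSeries.coeff j (s m i) = PowerSeries.coeff j (s (j + 1) i) := by
    intro j m hjm i
    induction m, hjm using Nat.le_induction with
    | base => rfl
    | succ m hm ih =>
      rw [← ih]
      have := PowerSeries.X_pow_dvd_iff.1 (h1 m i) j hm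
      rwa [map_sub, sub_eq_zero] at this
  let c : ι → PowerSeries R := fun i => PowerSeries.mk fun j => PowerSeries.coeff j (s (j + 1) i)
  have h3 : ∀ m i, PowerSeries.X ^ m ∣ c i - s m i := by
    intro m i
    rw [PowerSeries.X_pow_dvd_iff]
    intro j hj
    rw [map_sub, h2 j m hj i, PowerSeries.coeff_mk, sub_self]
  refine ⟨c, funext fun i => eq_of_forall_X_pow_dvd_sub fun m => ?_⟩
  have h4 := hG m c (s m) (h3 m) i
  rw [← hs] at h4
  have h5 := dvd_sub h4 (h3 (m + 1) i)
  refine (pow_dvd_pow _ m.le_succ).trans ?_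
  convert h5 using 1
  ring

/-! ### Newton's method at arcs with a dominant Jacobian minor -/

section Adapted

variable {k R : Type*} [CommRing k] [CommRing R] [Algebra k R] {n r d : ℕ}

/-- The square submatrix of the Jacobian matrix of `F` with columns `C`. -/
noncomputable def jacMinor (F : Fin r → MvPolynomial (Fin n) k) (C : Fin r → Fin n) :
    Matrix (Fin r) (Fin r) (MvPolynomial (Fin n) k) :=
  Matrix.of fun i j => pderiv (C j) (F i)

/-- The Jacobian matrix of `F`, multiplied by the adjugate of a square submatrix. -/
noncomputable def adjJac (F : Fin r → MvPolynomial (Fin n) k) (C : Fin r → Fin n) :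
    Matrix (Fin r) (Fin n) (MvPolynomial (Fin n) k) :=
  (jacMinor F C).adjugate * Matrix.of fun i j => pderiv j (F i)

lemma adjJac_apply_column (F : Fin r → MvPolynomial (Fin n) k) (C : Fin r → Fin n) (i j : Fin r) :
    adjJac F C i (C j) = if i = j then (jacMinor F C).det else 0 := by
  have := congr_fun (congr_fun (Matrix.adjugate_mul (jacMinor F C)) i) j
  rw [Matrix.smul_apply, Matrix.one_apply, smul_eq_mul, mul_ite, mul_one, mul_zero] at this
  exact this

/-- Cramer's rule. It turns a lower bound on the orders of all minors into the divisibility required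
in `IsAdapted`. -/
lemma adjJac_eq_det (F : Fin r → MvPolynomial (Fin n) k) (C : Fin r → Fin n) (i : Fin r)
    (j : Fin n) : adjJac F C i j = (jacMinor F (Function.update C i j)).det := by
  have h : adjJac F C i j = ((jacMinor F C).adjugate.mulVec fun l => pderiv j (F l)) i := rfl
  rw [h, ← Matrix.cramer_eq_adjugate_mulVec, Matrix.cramer_apply]
  congr 1
  ext l c
  by_cases hc : c = i
  · subst hc; simp [jacMinor]
  · simp [jacMinor, hc]

/-- The Jacobian minor of `F` with columns `C` has order exactly `m` at `a`, and the minors with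
one column exchanged have order at least `m`. -/
structure IsAdapted (F : Fin r → MvPolynomial (Fin n) k) (C : Fin r → Fin n) (m : ℕ)
    (a : Fin n → PowerSeries R) : Prop where
  det : ∃ v, IsUnit v ∧ aeval a (jacMinor F C).det = PowerSeries.X ^ m * v
  dvd : ∀ i j, PowerSeries.X ^ m ∣ aeval a (adjJac F C i j)

lemma isUnit_of_X_dvd_sub {φ ψ : PowerSeries R} (h : IsUnit φ) (hd : PowerSeries.X ∣ φ - ψ) :
    IsUnit ψ := by
  rw [PowerSeries.isUnit_iff_constantCoeff] at h ⊢
  rw [PowerSeries.X_dvd_iff, map_sub, sub_eq_zero] at hd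
  rwa [← hd]

/-- Only coefficients of order at most `m ≤ e` matter, so the condition depends on the e-jet alone.
-/
lemma IsAdapted.congr {F : Fin r → MvPolynomial (Fin n) k} {C : Fin r → Fin n} {m e : ℕ}
    (hme : m ≤ e) {a b : Fin n → PowerSeries R} (ha : IsAdapted F C m a)
    (hab : ∀ j, PowerSeries.X ^ (e + 1) ∣ a j - b j) : IsAdapted F C m b := by
  have hX : ∀ p : MvPolynomial (Fin n) k, PowerSeries.X ^ (m + 1) ∣ aeval a p - aeval b p :=
    fun p => (pow_dvd_pow _ (by omega)).trans (dvd_aeval_sub hab p)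
  refine ⟨?_, fun i j => ?_⟩
  · obtain ⟨v, hv, h⟩ := ha.det
    obtain ⟨w, hw⟩ := hX (jacMinor F C).det
    refine ⟨v - PowerSeries.X * w, isUnit_of_X_dvd_sub hv ⟨w, by ring⟩, ?_⟩
    rw [mul_sub, ← h, ← mul_assoc, ← pow_succ, ← hw]
    ring
  · exact (dvd_sub_right (ha.dvd i j)).1 ((pow_dvd_pow _ m.le_succ).trans (hX _))

lemma IsAdapted.map {R' : Type*} [CommRing R'] [Algebra k R'] (θ : R →ₐ[k] R')
    {F : Fin r → MvPolynomial (Fin n) k} {C : Fin r → Fin n} {m : ℕ} {a : Fin n → PowerSeries R}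
    (ha : IsAdapted F C m a) : IsAdapted F C m fun j => PowerSeries.mapAlgHom θ (a j) := by
  have h : ∀ p : MvPolynomial (Fin n) k, aeval (fun j => PowerSeries.mapAlgHom θ (a j)) p =
      PowerSeries.mapAlgHom θ (aeval a p) := fun p => (comp_aeval_apply _ _ _).symm
  refine ⟨?_, fun i j => ?_⟩
  · obtain ⟨v, hv, hv'⟩ := ha.det
    refine ⟨PowerSeries.mapAlgHom θ v, hv.map _, ?_⟩
    rw [h, hv', map_mul, map_pow, PowerSeries.mapAlgHom_apply, PowerSeries.map_X]
  · rw [h]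
    have := map_dvd (PowerSeries.mapAlgHom θ) (ha.dvd i j)
    rwa [map_pow, PowerSeries.mapAlgHom_apply, PowerSeries.map_X] at this

/-- A power of t times a unit is not a zero divisor in `R[[t]]`, even if `R` is not a domain, as for
rings of functions. -/
lemma IsAdapted.eq_zero {F : Fin r → MvPolynomial (Fin n) k} {C : Fin r → Fin n} {m : ℕ}
    {a : Fin n → PowerSeries R} (ha : IsAdapted F C m a) {φ : PowerSeries R}
    (h : aeval a (jacMinor F C).det * φ = 0) : φ = 0 := by
  obtain ⟨v, hv, hdet⟩ := ha.det
  rw [hdet, mul_assoc] at h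
  have := PowerSeries.X_pow_mul_cancel (h.trans (mul_zero _).symm)
  exact (hv.mul_right_eq_zero).1 this

/-- Solutions of `F = 0` which agree with an adapted vector to order `e` are determined by their
coordinates outside `C`, and so are their truncations. -/
lemma IsAdapted.dvd_sub_of_free {F : Fin r → MvPolynomial (Fin n) k} {σ : Fin r ⊕ Fin d ≃ Fin n}
    {m e : ℕ} (hme : m ≤ e) {a b : Fin n → PowerSeries R} (ha : IsAdapted F (σ ∘ Sum.inl) m a)
    (hab : ∀ j, PowerSeries.X ^ (e + 1) ∣ b j - a j) (hFa : ∀ i, aeval a (F i) = 0)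
    (hFb : ∀ i, aeval b (F i) = 0) {q : ℕ}
    (hq : ∀ o, PowerSeries.X ^ q ∣ b (σ (Sum.inr o)) - a (σ (Sum.inr o))) (j : Fin n) :
    PowerSeries.X ^ q ∣ b j - a j := by
  rcases Nat.lt_or_ge q (e + 1) with hqe | hqe
  · exact (pow_dvd_pow _ hqe.le).trans (hab j)
  -- The agreement of `a` and `b` is improved by one order at a time, starting from the common
  -- e-jet.
  suffices H : ∀ s, e + 1 ≤ s → s ≤ q → ∀ j, PowerSeries.X ^ s ∣ b j - a j from
    H q hqe le_rfl j
  intro s hs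
  induction s, hs using Nat.le_induction with
  | base => exact fun _ => hab
  | succ s hs ih =>
    intro hsq
    choose z hz using ih (by omega)
    have hb : b = fun j => a j + PowerSeries.X ^ s * z j := by
      ext1 j; rw [← hz]; ring
    choose Q hQ using fun i => exists_taylor a (PowerSeries.X ^ s) (F i)
    have h1 : ∀ i, ∑ j, aeval a (pderiv j (F i)) * z j + PowerSeries.X ^ s * aeval z (Q i) = 0 := by
      intro i
      have := hQ i z
      rw [← hb, hFa, hFb, zero_add, sq, mul_assoc, ← mul_add] at this
      exact PowerSeries.X_pow_mul_cancel (this.symm.trans (mul_zero _).symm)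
    have h2 : ∀ i, ∑ j, aeval a (adjJac F (σ ∘ Sum.inl) i j) * z j = -(PowerSeries.X ^ s *
        ∑ l, aeval a ((jacMinor F (σ ∘ Sum.inl)).adjugate i l) * aeval z (Q l)) := by
      intro i
      have : ∑ l, aeval a ((jacMinor F (σ ∘ Sum.inl)).adjugate i l) *
          (∑ j, aeval a (pderiv j (F l)) * z j + PowerSeries.X ^ s * aeval z (Q l)) = 0 := by
        simp only [h1, mul_zero, Finset.sum_const_zero]
      simp_rw [mul_add, Finset.sum_add_distrib] at this
      rw [eq_neg_iff_add_eq_zero, ← this]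
      congr 1
      · simp_rw [adjJac, Matrix.mul_apply, map_sum, map_mul, Finset.sum_mul, Finset.mul_sum]
        rw [Finset.sum_comm]
        simp_rw [mul_assoc]; rfl
      · rw [Finset.mul_sum]
        exact Finset.sum_congr rfl fun l _ => by ring
    have hzo : ∀ o, PowerSeries.X ∣ z (σ (Sum.inr o)) := by
      intro o
      have := (pow_dvd_pow PowerSeries.X hsq).trans (hq o)
      rw [hz, pow_succ] at this
      obtain ⟨w, hw⟩ := this
      exact ⟨w, PowerSeries.X_pow_mul_cancel (hw.trans (mul_assoc _ _ _))⟩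
    have hzc : ∀ c, PowerSeries.X ∣ z (σ (Sum.inl c)) := by
      intro c
      have h3 := h2 c
      rw [← Equiv.sum_comp σ, Fintype.sum_sum_type, Finset.sum_eq_single c] at h3
      · have h4 := adjJac_apply_column F (σ ∘ Sum.inl) c c
        rw [if_pos rfl, Function.comp_apply] at h4
        obtain ⟨v, hv, hdet⟩ := ha.det
        rw [h4, hdet] at h3
        choose w hw using fun o => ha.dvd c (σ (Sum.inr o))
        obtain ⟨z', hz'⟩ := Classical.axiomOfChoice hzo
        -- After cancelling t^m, the quadratic remainder still carries t^(s-m) with s > m. Modulo t,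
        -- the unit times `z` at a column of `C` is thus a combination of the free `z`, which vanish
        -- modulo t.
        have h5 : PowerSeries.X ^ m * (v * z (σ (Sum.inl c))) = PowerSeries.X ^ m *
            (-(PowerSeries.X ^ (s - m) * ∑ l, aeval a ((jacMinor F (σ ∘ Sum.inl)).adjugate c l) *
              aeval z (Q l)) - ∑ o, w o * z (σ (Sum.inr o))) := by
          rw [mul_sub, mul_neg, ← mul_assoc, ← mul_assoc, ← pow_add, Nat.add_sub_of_le (by omega),
            ← h3, Finset.mul_sum]
          simp_rw [hw, mul_assoc]
          ring
        have h6 := PowerSeries.X_pow_mul_cancel h5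
        have h7 : PowerSeries.X ∣ v * z (σ (Sum.inl c)) := by
          rw [h6]
          refine dvd_sub ((dvd_neg).2 (dvd_mul_of_dvd_left (dvd_pow_self _ (by omega)) _))
            (Finset.dvd_sum fun o _ => dvd_mul_of_dvd_right (hzo o) _)
        exact (hv.dvd_mul_left).1 h7
      · intro i _ hi
        have h4 := adjJac_apply_column F (σ ∘ Sum.inl) c i
        rw [if_neg hi.symm, Function.comp_apply] at h4
        rw [h4, map_zero, zero_mul]
      · simp
    intro j
    rw [hz, pow_succ]
    refine mul_dvd_mul_left _ ?_
    obtain ⟨t, rfl⟩ := σ.surjective j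
    rcases t with c | o
    exacts [hzc c, hzo o]

lemma IsAdapted.eq_of_free {F : Fin r → MvPolynomial (Fin n) k} {σ : Fin r ⊕ Fin d ≃ Fin n}
    {m e : ℕ} (hme : m ≤ e) {a b : Fin n → PowerSeries R} (ha : IsAdapted F (σ ∘ Sum.inl) m a)
    (hab : ∀ j, PowerSeries.X ^ (e + 1) ∣ b j - a j) (hFa : ∀ i, aeval a (F i) = 0)
    (hFb : ∀ i, aeval b (F i) = 0) (hq : ∀ o, b (σ (Sum.inr o)) = a (σ (Sum.inr o))) : b = a :=
  funext fun j => eq_of_forall_X_pow_dvd_sub fun _ =>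
    ha.dvd_sub_of_free hme hab hFa hFb (fun o => by simp [hq]) j

/-- Existence of solutions of `F = 0` near an approximate solution with prescribed coordinates
outside `C`. -/
lemma IsAdapted.exists_solution {F : Fin r → MvPolynomial (Fin n) k}
    {σ : Fin r ⊕ Fin d ≃ Fin n} {m e : ℕ} (hme : m ≤ e) {a : Fin n → PowerSeries R}
    (ha : IsAdapted F (σ ∘ Sum.inl) m a)
    (hF : ∀ i, PowerSeries.X ^ (e + 1 + m) ∣
      aeval a (∑ l, (jacMinor F (σ ∘ Sum.inl)).adjugate i l * F l))
    (y : Fin d → PowerSeries R) :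
    ∃ b : Fin n → PowerSeries R, (∀ i, aeval b (F i) = 0) ∧
      (∀ j, PowerSeries.X ^ (e + 1) ∣ b j - a j) ∧
      ∀ o, b (σ (Sum.inr o)) = a (σ (Sum.inr o)) + PowerSeries.X ^ (e + 1) * y o := by
  obtain ⟨v, ⟨v, rfl⟩, hdet⟩ := ha.det
  choose w hw using hF
  choose N hN using ha.dvd
  choose Q hQ using fun i => exists_taylor a (PowerSeries.X ^ (e + 1)) (F i)
  have hNc : ∀ c i, N c (σ (Sum.inl i)) = if c = i then (v : PowerSeries R) else 0 := by
    intro c i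
    have h4 := adjJac_apply_column F (σ ∘ Sum.inl) c i
    have h5 := hN c (σ (Sum.inl i))
    rw [Function.comp_apply] at h4
    rw [h4] at h5
    refine PowerSeries.X_pow_mul_cancel (k := m) ?_
    rw [← h5]
    split_ifs
    · exact hdet
    · simp
  let z : (Fin r → PowerSeries R) → Fin n → PowerSeries R := fun c j => Sum.elim c y (σ.symm j)
  have hzl : ∀ c i, z c (σ (Sum.inl i)) = c i := fun c i => by simp [z]
  have hzr : ∀ c o, z c (σ (Sum.inr o)) = y o := fun c o => by simp [z]
  let A : Fin r → Fin r → PowerSeries R :=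
    fun i l => aeval a ((jacMinor F (σ ∘ Sum.inl)).adjugate i l)
  -- The equation adj M · F(a + t^(e+1) z) = 0, divided by t^(e+1+m) and solved for the `C`-part of
  -- `z`. The factor t^(e+1-m), with exponent at least 1, makes it contracting.
  obtain ⟨c, hc⟩ := exists_fixed_point_of_contracting (fun c i =>
    -((v⁻¹ : (PowerSeries R)ˣ) : PowerSeries R) *
    (w i + ∑ o, N i (σ (Sum.inr o)) * y o +
      PowerSeries.X ^ (e + 1 - m) * ∑ l, A i l * aeval (z c) (Q l))) (by
    intro s c c' h i
    have hz : ∀ j, PowerSeries.X ^ s ∣ z c j - z c' j := by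
      intro j
      obtain ⟨t, rfl⟩ := σ.surjective j
      rcases t with i | o
      · rw [hzl, hzl]; exact h i
      · simp [hzr]
    rw [← mul_sub, add_sub_add_left_eq_sub, ← mul_sub, ← Finset.sum_sub_distrib]
    refine dvd_mul_of_dvd_right ?_ _
    rw [add_comm s, pow_add]
    refine mul_dvd_mul (pow_dvd_pow _ (by omega)) (Finset.dvd_sum fun l _ => ?_)
    rw [← mul_sub]
    exact dvd_mul_of_dvd_right (dvd_aeval_sub hz _) _)
  refine ⟨fun j => a j + PowerSeries.X ^ (e + 1) * z c j, ?_,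
    fun j => ⟨z c j, add_sub_cancel_left _ _⟩,
    fun o => by simp only [hzr]⟩
  have hb := fun i => hQ i (z c)
  have key : ∀ i,
      ∑ l, A i l * aeval (fun j => a j + PowerSeries.X ^ (e + 1) * z c j) (F l) = 0 := by
    intro i
    have h1 : (v : PowerSeries R) * c i + (w i + ∑ o, N i (σ (Sum.inr o)) * y o +
        PowerSeries.X ^ (e + 1 - m) * ∑ l, A i l * aeval (z c) (Q l)) = 0 := by
      have := congr_fun hc i
      rw [← this]
      simp only [neg_mul, mul_neg]
      rw [Units.mul_inv_cancel_left, neg_add_cancel]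
    have h2 : ∑ j, aeval a (adjJac F (σ ∘ Sum.inl) i j) * z c j =
        PowerSeries.X ^ m * ((v : PowerSeries R) * c i + ∑ o, N i (σ (Sum.inr o)) * y o) := by
      simp_rw [hN, mul_assoc]
      rw [← Finset.mul_sum, ← Equiv.sum_comp σ, Fintype.sum_sum_type]
      simp_rw [hNc, hzl, hzr]
      simp
    have h3 : ∑ j, aeval a (adjJac F (σ ∘ Sum.inl) i j) * z c j =
        ∑ l, A i l * ∑ j, aeval a (pderiv j (F l)) * z c j := by
      simp_rw [adjJac, Matrix.mul_apply, map_sum, map_mul, Finset.sum_mul, Finset.mul_sum]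
      rw [Finset.sum_comm]
      simp_rw [mul_assoc]; rfl
    have h4 : ∑ l, A i l * aeval a (F l) = PowerSeries.X ^ (e + 1 + m) * w i := by
      rw [← hw, map_sum]
      simp_rw [map_mul]; rfl
    have h5 : (PowerSeries.X : PowerSeries R) ^ (e + 1) * PowerSeries.X ^ m *
        PowerSeries.X ^ (e + 1 - m) = (PowerSeries.X ^ (e + 1)) ^ 2 := by
      rw [mul_assoc, ← pow_add, Nat.add_sub_of_le (by omega), sq]
    calc _ = ∑ l, A i l * aeval a (F l) + PowerSeries.X ^ (e + 1) *
          (∑ l, A i l * ∑ j, aeval a (pderiv j (F l)) * z c j) +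
          (PowerSeries.X ^ (e + 1)) ^ 2 * ∑ l, A i l * aeval (z c) (Q l) := by
          simp_rw [hb, Finset.mul_sum (s := (Finset.univ : Finset (Fin r))),
            ← Finset.sum_add_distrib]
          exact Finset.sum_congr rfl fun l _ => by ring
      _ = 0 := by
          rw [h4, ← h3, h2, ← h5, pow_add]
          linear_combination (PowerSeries.X ^ (e + 1) * PowerSeries.X ^ m) * h1
  intro l
  -- Multiplying adj M · F(b) = 0 by M gives det M · F(b) = 0, and det M can be cancelled.
  refine ha.eq_zero ?_
  have h6 : ∑ i, aeval a (jacMinor F (σ ∘ Sum.inl) l i) *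
      ∑ l, A i l * aeval (fun j => a j + PowerSeries.X ^ (e + 1) * z c j) (F l) = 0 := by
    simp [key]
  rw [← h6]
  simp_rw [Finset.mul_sum]
  rw [Finset.sum_comm]
  simp_rw [← mul_assoc, A, ← map_mul, ← Finset.sum_mul, ← map_sum, ← Matrix.mul_apply,
    Matrix.mul_adjugate, Matrix.smul_apply, Matrix.one_apply]
  simp [apply_ite (aeval a)]

end Adapted

/-! ### Deformations inside F = 0 stay in X -/

section Deformation

variable {k : Type*} [Field k]

/-- The derivative of the coefficients of a power series over `k[s]` with respect to `s`. -/
noncomputable def coeffDerivative (k : Type*) [Field k] :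
    Derivation k (PowerSeries (Polynomial k)) (PowerSeries (Polynomial k)) :=
  Derivation.mk'
    { toFun := fun φ => PowerSeries.mk fun j => Polynomial.derivative (PowerSeries.coeff j φ)
      map_add' := fun φ ψ => by ext1 j; simp
      map_smul' := fun c φ => by
        ext1 j
        simp only [PowerSeries.coeff_mk, RingHom.id_apply]
        rw [LinearMap.map_smul_of_tower, LinearMap.map_smul_of_tower, LinearMap.map_smul_of_tower,
          PowerSeries.coeff_mk] }
    (fun φ ψ => by
      ext1 j
      simp only [LinearMap.coe_mk, AddHom.coe_mk, PowerSeries.coeff_mk, smul_eq_mul, map_add,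
        PowerSeries.coeff_mul, Polynomial.derivative_sum, Polynomial.derivative_mul]
      rw [← Finset.Nat.sum_antidiagonal_swap (f := fun x => PowerSeries.coeff x.1 ψ * _),
        ← Finset.sum_add_distrib]
      exact Finset.sum_congr rfl fun x _ => by simp; ring)

lemma coeffDerivative_apply (φ : PowerSeries (Polynomial k)) :
    coeffDerivative k φ =
      PowerSeries.mk fun j => Polynomial.derivative (PowerSeries.coeff j φ) := rfl

/-- The parameter `s` as an element of `k[s][[t]]`. -/
noncomputable abbrev param (k : Type*) [Field k] : PowerSeries (Polynomial k) :=
  PowerSeries.C Polynomial.X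

lemma coeffDerivative_param : coeffDerivative k (param k) = 1 := by
  ext1 j
  rw [coeffDerivative_apply, PowerSeries.coeff_mk, PowerSeries.coeff_C, PowerSeries.coeff_one]
  split_ifs <;> simp

/-- Specialization of the parameter in `k[s][[t]]`. -/
noncomputable abbrev specialize (c : k) : PowerSeries (Polynomial k) →ₐ[k] PowerSeries k :=
  PowerSeries.mapAlgHom (Polynomial.aeval c)

lemma param_dvd_iff {φ : PowerSeries (Polynomial k)} :
    param k ∣ φ ↔ specialize 0 φ = 0 := by
  constructor
  · rintro ⟨ψ, rfl⟩
    rw [map_mul, PowerSeries.mapAlgHom_apply, PowerSeries.map_C]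
    simp
  · intro h
    have : ∀ j, Polynomial.X ∣ PowerSeries.coeff j φ := by
      intro j
      have h1 := congr_arg (PowerSeries.coeff j) h
      rw [PowerSeries.mapAlgHom_apply, PowerSeries.coeff_map] at h1
      rw [Polynomial.X_dvd_iff, Polynomial.coeff_zero_eq_aeval_zero]
      simpa using h1
    choose q hq using this
    refine ⟨PowerSeries.mk q, ?_⟩
    ext1 j
    rw [PowerSeries.coeff_C_mul, PowerSeries.coeff_mk, hq]

lemma eq_zero_of_param_pow_dvd {φ : PowerSeries (Polynomial k)} (h : ∀ m, param k ^ m ∣ φ) :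
    φ = 0 := by
  ext j m
  obtain ⟨ψ, rfl⟩ := h (m + 1)
  rw [← map_pow, PowerSeries.coeff_C_mul]
  have := Polynomial.X_pow_dvd_iff.1 (dvd_mul_right (Polynomial.X ^ (m + 1))
    (PowerSeries.coeff j ψ)) m m.lt_succ_self
  simpa using this

/-- The gradient relation `det_mul_mem_radical` in terms of the velocity of a deformation inside
`F = 0`. -/
lemma det_sq_mul_derivation_mem [CharZero k] {B : Type*} [CommRing B] [Algebra k B] {n r d : ℕ}
    {I : Ideal (MvPolynomial (Fin n) k)}
    (hI : ∀ P ∈ I.minimalPrimes, ringKrullDim (MvPolynomial (Fin n) k ⧸ P) = (d : WithBot ℕ∞))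
    (σ : Fin r ⊕ Fin d ≃ Fin n) (F : Fin r → MvPolynomial (Fin n) k) (hF : ∀ i, F i ∈ I.radical)
    (D : Derivation k B B) (b : Fin n → B) (hb : ∀ i, aeval b (F i) = 0)
    (g : MvPolynomial (Fin n) k) (hg : g ∈ I.radical) {s : B}
    (hs : ∀ h ∈ I.radical, s ∣ aeval b h) :
    s ∣ aeval b (jacMinor F (σ ∘ Sum.inl)).det ^ 2 * D (aeval b g) := by
  set M := jacMinor F (σ ∘ Sum.inl) with hM
  -- Differentiating F(b) = 0 gives linear relations for the velocity `D b`. Cramer elimination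
  -- expresses its `C`-components by the free ones.
  have key : ∀ i, aeval b M.det * D (b (σ (Sum.inl i))) =
      -∑ o, (∑ l, aeval b (M.adjugate i l) * aeval b (pderiv (σ (Sum.inr o)) (F l))) *
        D (b (σ (Sum.inr o))) := by
    intro i
    have h0 : ∀ l, ∑ c, aeval b (M l c) * D (b (σ (Sum.inl c))) =
        -∑ o, aeval b (pderiv (σ (Sum.inr o)) (F l)) * D (b (σ (Sum.inr o))) := by
      intro l
      have := derivation_aeval D b (F l)
      rw [hb, map_zero, ← Equiv.sum_comp σ, Fintype.sum_sum_type] at this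
      exact eq_neg_of_add_eq_zero_left this.symm
    have h1 : ∑ l, aeval b (M.adjugate i l) * ∑ c, aeval b (M l c) * D (b (σ (Sum.inl c))) =
        aeval b M.det * D (b (σ (Sum.inl i))) := by
      simp_rw [Finset.mul_sum, ← mul_assoc]
      rw [Finset.sum_comm]
      simp_rw [← Finset.sum_mul, ← map_mul, ← map_sum, ← Matrix.mul_apply, Matrix.adjugate_mul,
        Matrix.smul_apply, Matrix.one_apply]
      simp [apply_ite (aeval b)]
    rw [← h1]
    simp_rw [h0, mul_neg, Finset.sum_neg_distrib, Finset.mul_sum, Finset.sum_mul]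
    rw [Finset.sum_comm]
    simp_rw [mul_assoc]
  have h2 : aeval b M.det ^ 2 * D (aeval b g) = ∑ o, aeval b (M.det *
      (M.det * pderiv (σ (Sum.inr o)) g - ∑ i, ∑ l, pderiv (σ (Sum.inl i)) g *
        M.adjugate i l * pderiv (σ (Sum.inr o)) (F l))) * D (b (σ (Sum.inr o))) := by
    rw [derivation_aeval, ← Equiv.sum_comp σ, Fintype.sum_sum_type]
    simp_rw [smul_eq_mul]
    have h3 : aeval b M.det *
        ∑ i, aeval b (pderiv (σ (Sum.inl i)) g) * D (b (σ (Sum.inl i))) =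
        -∑ o, (∑ i, ∑ l, aeval b (pderiv (σ (Sum.inl i)) g) * aeval b (M.adjugate i l) *
          aeval b (pderiv (σ (Sum.inr o)) (F l))) * D (b (σ (Sum.inr o))) := by
      simp_rw [Finset.mul_sum, mul_left_comm (aeval b M.det), key, mul_neg,
        Finset.sum_neg_distrib, Finset.mul_sum, Finset.sum_mul]
      rw [Finset.sum_comm]
      simp_rw [Finset.mul_sum, mul_assoc]
    rw [sq, mul_assoc, mul_add, h3, Finset.mul_sum, ← sub_eq_neg_add, ← Finset.sum_sub_distrib,
      Finset.mul_sum]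
    refine Finset.sum_congr rfl fun o _ => ?_
    simp only [map_mul, map_sub, map_sum]
    ring
  rw [h2]
  exact Finset.dvd_sum fun o _ => dvd_mul_of_dvd_left
    (hs _ (det_mul_mem_radical hI σ F hF g hg o rfl)) _

/-- Two arcs of `F = 0` with the same truncation at which a maximal minor of the Jacobian matrix
does not vanish lie in the same components of `F = 0`. -/
lemma aeval_eq_zero_of_mem_radical [CharZero k] {n r d : ℕ} {I : Ideal (MvPolynomial (Fin n) k)}
    (hI : ∀ P ∈ I.minimalPrimes, ringKrullDim (MvPolynomial (Fin n) k ⧸ P) = (d : WithBot ℕ∞))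
    {σ : Fin r ⊕ Fin d ≃ Fin n} {F : Fin r → MvPolynomial (Fin n) k} (hF : ∀ i, F i ∈ I.radical)
    {m e : ℕ} (hme : m ≤ e) {a b : Fin n → PowerSeries k} (ha : IsAdapted F (σ ∘ Sum.inl) m a)
    (hab : ∀ j, PowerSeries.X ^ (e + 1) ∣ b j - a j) (hFb : ∀ i, aeval b (F i) = 0)
    (hIa : ∀ g ∈ I.radical, aeval a g = 0) :
    ∀ g ∈ I.radical, aeval b g = 0 := by
  let ι : PowerSeries k →ₐ[k] PowerSeries (Polynomial k) :=
    PowerSeries.mapAlgHom (Algebra.ofId k (Polynomial k))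
  have hFa : ∀ i, aeval a (F i) = 0 := fun i => hIa _ (hF i)
  have hsι : ∀ (c : k) φ, specialize c (ι φ) = φ := by
    intro c φ
    ext j
    simp only [ι, PowerSeries.mapAlgHom_apply, PowerSeries.coeff_map]
    change Polynomial.aeval c (algebraMap k (Polynomial k) _) = _
    simp
  have hFa' : ∀ i, aeval (fun j => ι (a j)) (F i) = 0 := fun i =>
    (comp_aeval_apply a ι (F i)).symm.trans (by rw [hFa, map_zero])
  choose y hy using hab
  have ha' := ha.map (Algebra.ofId k (Polynomial k))
  -- The free coordinates of `β` move linearly from those of `a` to those of `b`. By uniqueness, `β`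
  -- specializes to `a` at parameter 0 and to `b` at parameter 1.
  obtain ⟨β, hFβ, hβa, hβ⟩ := ha'.exists_solution hme (fun i => by
    rw [map_sum]
    refine Finset.dvd_sum fun l _ => ?_
    rw [map_mul, hFa' l, mul_zero]
    exact dvd_zero _) (fun o => param k * ι (y (σ (Sum.inr o))))
  have hmap : ∀ (c : k) (p : MvPolynomial (Fin n) k),
      aeval (fun j => specialize c (β j)) p = specialize c (aeval β p) :=
    fun c p => (comp_aeval_apply _ _ _).symm
  have hsX : ∀ c : k, specialize c PowerSeries.X = PowerSeries.X := fun c => by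
    rw [PowerSeries.mapAlgHom_apply, PowerSeries.map_X]
  have hsβ : ∀ (c : k) (j), PowerSeries.X ^ (e + 1) ∣ specialize c (β j) - a j := by
    intro c j
    have := map_dvd (specialize c) (hβa j)
    rwa [map_sub, map_pow, hsX, show specialize c (PowerSeries.mapAlgHom
      (Algebra.ofId k (Polynomial k)) (a j)) = a j from hsι c (a j)] at this
  have hsfree : ∀ (c : k) (o), specialize c (β (σ (Sum.inr o))) =
      a (σ (Sum.inr o)) + PowerSeries.X ^ (e + 1) * (PowerSeries.C c * y (σ (Sum.inr o))) := by
    intro c o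
    have hp : specialize c (param k) = PowerSeries.C c := by
      rw [PowerSeries.mapAlgHom_apply, PowerSeries.map_C]
      simp
    have ha0 : specialize c (PowerSeries.mapAlgHom (Algebra.ofId k (Polynomial k))
      (a (σ (Sum.inr o)))) = a (σ (Sum.inr o)) := hsι c _
    rw [hβ, map_add, map_mul, map_pow, hsX, map_mul, ha0, hp, hsι]
  have h0 : (fun j => specialize 0 (β j)) = a :=
    ha.eq_of_free hme (hsβ 0) hFa (fun i => by rw [hmap, hFβ, map_zero])
      (fun o => by rw [hsfree]; simp)
  have h1 : (fun j => specialize 1 (β j)) = b := by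
    have hb : IsAdapted F (σ ∘ Sum.inl) m b :=
      ha.congr hme fun j => (dvd_sub_comm).1 ⟨y j, hy j⟩
    refine hb.eq_of_free hme (fun j => ?_) hFb (fun i => by rw [hmap, hFβ, map_zero]) fun o => ?_
    · simpa using dvd_sub (hsβ 1 j) (Dvd.intro _ (hy j).symm)
    · rw [hsfree, map_one, one_mul, ← hy]
      ring
  have hdet0 : specialize 0 (aeval β (jacMinor F (σ ∘ Sum.inl)).det) ≠ 0 := by
    rw [← hmap, h0]
    intro h
    exact one_ne_zero (ha.eq_zero (by rw [h, zero_mul]))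
  have key : ∀ s : ℕ, ∀ g ∈ I.radical, param k ^ s ∣ aeval β g := by
    intro s
    induction s with
    | zero => simp
    | succ s ih =>
      intro g hg
      rcases Nat.eq_zero_or_pos s with rfl | hs
      · rw [zero_add, pow_one, param_dvd_iff, ← hmap, h0, hIa g hg]
      · obtain ⟨h, hh⟩ := ih g hg
        -- With g(β) = s^N h, the derivative is N s^(N-1) h + s^N h'. As s^N divides it after
        -- multiplication by det², setting s = 0 yields N · det(a)² · h(0) = 0, and in
        -- characteristic 0 this forces s ∣ h.
        have h2 := det_sq_mul_derivation_mem hI σ F hF (coeffDerivative k) β hFβ g hg ih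
        rw [hh, Derivation.leibniz, Derivation.leibniz_pow, coeffDerivative_param, smul_eq_mul,
          mul_add] at h2
        have h3 := (dvd_add_right (dvd_mul_of_dvd_right (dvd_mul_right _ _) _)).1 h2
        obtain ⟨s, rfl⟩ := Nat.exists_eq_succ_of_ne_zero hs.ne'
        have h4 : param k ^ s * param k ∣ param k ^ s *
            (aeval β (jacMinor F (σ ∘ Sum.inl)).det ^ 2 * (((s + 1 : ℕ) : PowerSeries _) * h)) := by
          rw [← pow_succ]
          convert h3 using 1
          simp only [smul_eq_mul, nsmul_eq_mul, mul_one, Nat.succ_eq_add_one, Nat.add_sub_cancel]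
          ring
        have hne : param k ^ s ≠ 0 := pow_ne_zero _ (by
          rw [Ne, map_eq_zero_iff _ PowerSeries.C_injective]; exact Polynomial.X_ne_zero)
        rw [mul_dvd_mul_iff_left hne, param_dvd_iff, map_mul, map_mul, map_pow, map_natCast] at h4
        have : CharZero (PowerSeries k) :=
          charZero_of_injective_algebraMap (algebraMap k (PowerSeries k)).injective
        have hcz : ((s + 1 : ℕ) : PowerSeries k) ≠ 0 := Nat.cast_ne_zero.2 s.succ_ne_zero
        have h5 : specialize 0 h = 0 :=
          ((mul_eq_zero.1 ((mul_eq_zero.1 h4).resolve_left (pow_ne_zero _ hdet0))).resolve_left hcz)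
        rw [hh, pow_succ _ (s + 1)]
        exact mul_dvd_mul_left _ (param_dvd_iff.2 h5)
  intro g hg
  rw [← h1, hmap, eq_zero_of_param_pow_dvd fun s => key s g hg, map_zero]

end Deformation

/-! ### Regular families as power series over rings of functions -/

section RegularFunctions

variable {k Ω ι : Type*} [Field k]

/-- The functions on `Ω` which are quotients of polynomials in the coordinates `u` by powers
of `δ`. -/
def regularFunctions (u : Ω → ι → k) (δ : MvPolynomial ι k) : Subalgebra k (Ω → k) where
  carrier := {h | ∃ (P : MvPolynomial ι k) (N : ℕ), ∀ ω, h ω * eval (u ω) δ ^ N = eval (u ω) P}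
  mul_mem' := by
    rintro h h' ⟨P, N, hP⟩ ⟨P', N', hP'⟩
    refine ⟨P * P', N + N', fun ω => ?_⟩
    rw [map_mul, ← hP, ← hP', Pi.mul_apply]
    ring
  add_mem' := by
    rintro h h' ⟨P, N, hP⟩ ⟨P', N', hP'⟩
    refine ⟨P * δ ^ N' + P' * δ ^ N, N + N', fun ω => ?_⟩
    rw [map_add, map_mul, map_mul, map_pow, map_pow, ← hP, ← hP', Pi.add_apply]
    ring
  algebraMap_mem' := fun c => ⟨C c, 0, fun ω => by simp⟩

lemma const_mem_regularFunctions (u : Ω → ι → k) (δ : MvPolynomial ι k) (c : k) :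
    (fun _ => c) ∈ regularFunctions u δ :=
  ⟨C c, 0, fun ω => by simp⟩

/-- A family of power series with coefficients in an algebra of functions, as a power series
over this algebra. -/
noncomputable def bundle (𝓢 : Subalgebra k (Ω → k)) (φ : Ω → PowerSeries k)
    (h : ∀ i, (fun ω => PowerSeries.coeff i (φ ω)) ∈ 𝓢) : PowerSeries 𝓢 :=
  PowerSeries.mk fun i => ⟨_, h i⟩

/-- Evaluation at a point, for power series over an algebra of functions. -/
noncomputable def evalAt (𝓢 : Subalgebra k (Ω → k)) (ω : Ω) : PowerSeries 𝓢 →ₐ[k] PowerSeries k :=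
  PowerSeries.mapAlgHom ((Pi.evalAlgHom k (fun _ => k) ω).comp 𝓢.val)

lemma coeff_evalAt (𝓢 : Subalgebra k (Ω → k)) (ω : Ω) (φ : PowerSeries 𝓢) (i : ℕ) :
    PowerSeries.coeff i (evalAt 𝓢 ω φ) = ((PowerSeries.coeff i φ : 𝓢) : Ω → k) ω := by
  rw [evalAt, PowerSeries.mapAlgHom_apply, PowerSeries.coeff_map]
  rfl

lemma evalAt_bundle (𝓢 : Subalgebra k (Ω → k)) (φ : Ω → PowerSeries k)
    (h : ∀ i, (fun ω => PowerSeries.coeff i (φ ω)) ∈ 𝓢) (ω : Ω) :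
    evalAt 𝓢 ω (bundle 𝓢 φ h) = φ ω := by
  ext i
  rw [coeff_evalAt, bundle, PowerSeries.coeff_mk]

lemma evalAt_X (𝓢 : Subalgebra k (Ω → k)) (ω : Ω) : evalAt 𝓢 ω PowerSeries.X = PowerSeries.X := by
  rw [evalAt, PowerSeries.mapAlgHom_apply, PowerSeries.map_X]

lemma X_pow_dvd_iff_evalAt (𝓢 : Subalgebra k (Ω → k)) (φ : PowerSeries 𝓢) (m : ℕ) :
    PowerSeries.X ^ m ∣ φ ↔ ∀ ω, PowerSeries.X ^ m ∣ evalAt 𝓢 ω φ := by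
  simp_rw [PowerSeries.X_pow_dvd_iff, coeff_evalAt]
  constructor
  · intro h ω i hi
    rw [h i hi]
    rfl
  · intro h i hi
    ext ω
    exact h ω i hi

/-- The family is a single vector of power series over `𝓢`: `P` is evaluated there and then
specialized at the points of `Ω`. -/
lemma coeff_aeval_mem {n : ℕ} (𝓢 : Subalgebra k (Ω → k)) (a : Ω → Series k n)
    (h : ∀ j i, (fun ω => PowerSeries.coeff i (a ω j)) ∈ 𝓢) (P : MvPolynomial (Fin n) k) (i : ℕ) :
    (fun ω => PowerSeries.coeff i (aeval (a ω) P)) ∈ 𝓢 := by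
  have : (fun ω => PowerSeries.coeff i (aeval (a ω) P)) =
      ((PowerSeries.coeff i (aeval (fun j => bundle 𝓢 (fun ω => a ω j) (h j)) P) : 𝓢) : Ω → k) := by
    ext ω
    rw [← coeff_evalAt, comp_aeval_apply]
    simp_rw [evalAt_bundle]
  rw [this]
  exact Subtype.property _

/-- Solutions of `F = 0` near a regular family of approximate solutions form a regular family. -/
lemma exists_regular_solution {n r d : ℕ} {u : Ω → ι → k} {δ : MvPolynomial ι k}
    (hδ : ∀ ω, eval (u ω) δ ≠ 0) {F : Fin r → MvPolynomial (Fin n) k}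
    {σ : Fin r ⊕ Fin d ≃ Fin n} {m e : ℕ} (hme : m ≤ e) {a : Ω → Series k n}
    (ha : ∀ j i, (fun ω => PowerSeries.coeff i (a ω j)) ∈ regularFunctions u δ)
    (hdet : ∀ ω, PowerSeries.X ^ m ∣ aeval (a ω) (jacMinor F (σ ∘ Sum.inl)).det)
    (hdetδ : ∀ ω, PowerSeries.coeff m (aeval (a ω) (jacMinor F (σ ∘ Sum.inl)).det) = eval (u ω) δ)
    (hadj : ∀ ω i j, PowerSeries.X ^ m ∣ aeval (a ω) (adjJac F (σ ∘ Sum.inl) i j))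
    (hF : ∀ ω i, PowerSeries.X ^ (e + 1 + m) ∣
      aeval (a ω) (∑ l, (jacMinor F (σ ∘ Sum.inl)).adjugate i l * F l))
    (y : Ω → Series k d)
    (hy : ∀ j i, (fun ω => PowerSeries.coeff i (y ω j)) ∈ regularFunctions u δ) :
    ∃ b : Ω → Series k n,
      (∀ j i, (fun ω => PowerSeries.coeff i (b ω j)) ∈ regularFunctions u δ) ∧
      (∀ ω i, aeval (b ω) (F i) = 0) ∧
      (∀ ω j, PowerSeries.X ^ (e + 1) ∣ b ω j - a ω j) ∧
      ∀ ω o, b ω (σ (Sum.inr o)) = a ω (σ (Sum.inr o)) + PowerSeries.X ^ (e + 1) * y ω o := by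
  set 𝓢 := regularFunctions u δ
  let A : Fin n → PowerSeries 𝓢 := fun j => bundle 𝓢 (fun ω => a ω j) (ha j)
  let Y : Fin d → PowerSeries 𝓢 := fun j => bundle 𝓢 (fun ω => y ω j) (hy j)
  have hA : ∀ ω P, evalAt 𝓢 ω (aeval A P) = aeval (a ω) (P : MvPolynomial (Fin n) k) := by
    intro ω P
    rw [comp_aeval_apply]
    simp_rw [A, evalAt_bundle]
  have hAd : IsAdapted F (σ ∘ Sum.inl) m A := by
    refine ⟨?_, fun i j => ?_⟩
    · obtain ⟨v, hv⟩ := (X_pow_dvd_iff_evalAt 𝓢 (aeval A (jacMinor F (σ ∘ Sum.inl)).det) m).2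
        fun ω => by rw [hA]; exact hdet ω
      refine ⟨v, ?_, hv⟩
      rw [PowerSeries.isUnit_iff_constantCoeff]
      -- The leading coefficient of the minor is `δ`, whose inverse belongs to `𝓢`; this makes the
      -- generic vector `A` adapted.
      let w : 𝓢 := ⟨fun ω => (eval (u ω) δ)⁻¹, 1, 1, fun ω => by
        rw [pow_one, map_one, inv_mul_cancel₀ (hδ ω)]⟩
      refine IsUnit.of_mul_eq_one w ?_
      ext ω
      have h1 : ((PowerSeries.constantCoeff v : 𝓢) : Ω → k) ω = eval (u ω) δ := by
        rw [← hdetδ, ← hA, hv, map_mul, map_pow, evalAt_X, PowerSeries.coeff_X_pow_mul',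
          if_pos le_rfl, Nat.sub_self, coeff_evalAt, PowerSeries.coeff_zero_eq_constantCoeff]
      change ((PowerSeries.constantCoeff v : 𝓢) : Ω → k) ω * (eval (u ω) δ)⁻¹ = 1
      rw [h1, mul_inv_cancel₀ (hδ ω)]
    · rw [X_pow_dvd_iff_evalAt]
      intro ω
      rw [hA]
      exact hadj ω i j
  obtain ⟨B, hB, hBA, hBO⟩ := hAd.exists_solution hme (fun i => by
    rw [X_pow_dvd_iff_evalAt]
    intro ω
    rw [hA]
    exact hF ω i) Y
  refine ⟨fun ω j => evalAt 𝓢 ω (B j), fun j i => ?_, fun ω i => ?_, fun ω j => ?_, fun ω o => ?_⟩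
  · simp_rw [coeff_evalAt]
    exact (PowerSeries.coeff i (B j)).2
  · rw [← comp_aeval_apply, hB, map_zero]
  · have := map_dvd (evalAt 𝓢 ω) (hBA j)
    rwa [map_sub, map_pow, evalAt_X, evalAt_bundle] at this
  · have := congr_arg (evalAt 𝓢 ω) (hBO o)
    rwa [map_add, map_mul, map_pow, evalAt_X, evalAt_bundle, evalAt_bundle] at this

end RegularFunctions

/-! ### Jets, their polynomial lifts and their values -/

section Jets

variable {k : Type*} [Field k] {n : ℕ}

/-- The polynomial lift of a jet. -/
noncomputable def jetSeries {q : ℕ} (α : Jet k n q) : Series k n :=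
  fun j => PowerSeries.mk fun i => if h : i < q + 1 then α (j, ⟨i, h⟩) else 0

lemma coeff_jetSeries {q : ℕ} (α : Jet k n q) (j : Fin n) (i : ℕ) :
    PowerSeries.coeff i (jetSeries α j) = if h : i < q + 1 then α (j, ⟨i, h⟩) else 0 :=
  PowerSeries.coeff_mk _ _

lemma trunc_jetSeries {q : ℕ} (α : Jet k n q) : trunc q (jetSeries α) = α := by
  ext ⟨j, i⟩
  simp [trunc, coeff_jetSeries, i.2]

lemma trunc_eq_iff {q : ℕ} {a b : Series k n} :
    trunc q a = trunc q b ↔ ∀ j, PowerSeries.X ^ (q + 1) ∣ a j - b j := by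
  simp_rw [PowerSeries.X_pow_dvd_iff, map_sub, sub_eq_zero]
  constructor
  · intro h j i hi
    exact congr_fun h (j, ⟨i, hi⟩)
  · intro h
    ext ⟨j, i⟩
    exact h j i i.2

lemma dvd_jetSeries_sub {q : ℕ} {α : Jet k n q} {a : Series k n} (h : trunc q a = α) (j : Fin n) :
    PowerSeries.X ^ (q + 1) ∣ jetSeries α j - a j :=
  trunc_eq_iff.1 ((trunc_jetSeries α).trans h.symm) j

lemma coeff_jetSeries_mem {Ω : Type*} {q : ℕ} (𝓢 : Subalgebra k (Ω → k)) (s : Ω → Jet k n q)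
    (hs : ∀ i, (fun ω => s ω i) ∈ 𝓢) (j : Fin n) (i : ℕ) :
    (fun ω => PowerSeries.coeff i (jetSeries (s ω) j)) ∈ 𝓢 := by
  simp_rw [coeff_jetSeries]
  split_ifs
  · exact hs _
  · exact 𝓢.zero_mem

/-- For denominator 1 the regular functions are the polynomial functions, and the lift of a jet has
coordinates of the jet, or 0, as coefficients. -/
lemma exists_jetCoeff (q : ℕ) (P : MvPolynomial (Fin n) k) (i : ℕ) :
    ∃ c : MvPolynomial (Fin n × Fin (q + 1)) k, ∀ α : Jet k n q,
      eval α c = PowerSeries.coeff i (aeval (jetSeries α) P) := by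
  obtain ⟨c, N, hc⟩ := coeff_aeval_mem
    (regularFunctions (fun α : Jet k n q => α) (1 : MvPolynomial (Fin n × Fin (q + 1)) k))
    jetSeries (coeff_jetSeries_mem _ _ fun i => ⟨X i, 0, by simp⟩) P i
  exact ⟨c, fun α => by simpa using (hc α).symm⟩

/-- The `i`-th coefficient of the value of `P` at a jet, as a polynomial in the jet. -/
noncomputable def jetCoeff (q : ℕ) (P : MvPolynomial (Fin n) k) (i : ℕ) :
    MvPolynomial (Fin n × Fin (q + 1)) k := (exists_jetCoeff q P i).choose

lemma eval_jetCoeff {q : ℕ} (P : MvPolynomial (Fin n) k) (i : ℕ) (α : Jet k n q) :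
    eval α (jetCoeff q P i) = PowerSeries.coeff i (aeval (jetSeries α) P) :=
  (exists_jetCoeff q P i).choose_spec α

lemma eval_jetCoeff_of_trunc {q : ℕ} (P : MvPolynomial (Fin n) k) {i : ℕ} (hi : i ≤ q)
    {α : Jet k n q} {a : Series k n} (h : trunc q a = α) :
    eval α (jetCoeff q P i) = PowerSeries.coeff i (aeval a P) := by
  have := PowerSeries.X_pow_dvd_iff.1 (dvd_aeval_sub (dvd_jetSeries_sub h) P) i (by omega)
  rw [eval_jetCoeff]
  rwa [map_sub, sub_eq_zero] at this

end Jets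

/-- A jet of a solution is an approximate solution of higher order. -/
lemma IsAdapted.dvd_adjugate_mul {k R : Type*} [CommRing k] [CommRing R] [Algebra k R] {n r : ℕ}
    {F : Fin r → MvPolynomial (Fin n) k}
    {C : Fin r → Fin n} {m e : ℕ} (hme : m ≤ e) {a b : Fin n → PowerSeries R}
    (ha : IsAdapted F C m a) (hFa : ∀ i, aeval a (F i) = 0)
    (hab : ∀ j, PowerSeries.X ^ (e + 1) ∣ b j - a j) (i : Fin r) :
    PowerSeries.X ^ (e + 1 + m) ∣ aeval b (∑ l, (jacMinor F C).adjugate i l * F l) := by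
  have hX := dvd_aeval_sub (k := k) hab
  choose z hz using hab
  have hb : b = fun j => a j + PowerSeries.X ^ (e + 1) * z j := by
    ext1 j; rw [← hz]; ring
  choose Q hQ using fun i => exists_taylor a (PowerSeries.X ^ (e + 1)) (F i)
  have h1 : ∀ l, aeval b (F l) = PowerSeries.X ^ (e + 1) *
      ∑ j, aeval a (pderiv j (F l)) * z j + (PowerSeries.X ^ (e + 1)) ^ 2 * aeval z (Q l) := by
    intro l
    have := hQ l z
    rwa [← hb, hFa, zero_add] at this
  have h2 : ∑ l, aeval a ((jacMinor F C).adjugate i l) * ∑ j, aeval a (pderiv j (F l)) * z j =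
      ∑ j, aeval a (adjJac F C i j) * z j := by
    simp_rw [adjJac, Matrix.mul_apply, map_sum, map_mul, Finset.sum_mul, Finset.mul_sum]
    rw [Finset.sum_comm]
    simp_rw [mul_assoc]; rfl
  -- The adjugate at `b` is replaced by the one at `a`. The error times F(b) is a product of two
  -- multiples of t^(e+1), and 2(e+1) ≥ e+1+m.
  have h3 : aeval b (∑ l, (jacMinor F C).adjugate i l * F l) =
      ∑ l, (aeval b ((jacMinor F C).adjugate i l) - aeval a ((jacMinor F C).adjugate i l)) *
        aeval b (F l) + PowerSeries.X ^ (e + 1) * ∑ j, aeval a (adjJac F C i j) * z j +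
      (PowerSeries.X ^ (e + 1)) ^ 2 *
        ∑ l, aeval a ((jacMinor F C).adjugate i l) * aeval z (Q l) := by
    rw [← h2, map_sum, Finset.mul_sum, Finset.mul_sum, ← Finset.sum_add_distrib,
      ← Finset.sum_add_distrib]
    refine Finset.sum_congr rfl fun l _ => ?_
    rw [map_mul, h1 l]
    ring
  have hpow : (PowerSeries.X : PowerSeries R) ^ (e + 1 + m) ∣ (PowerSeries.X ^ (e + 1)) ^ 2 := by
    rw [← pow_mul]; exact pow_dvd_pow _ (by omega)
  rw [h3]
  refine dvd_add (dvd_add (Finset.dvd_sum fun l _ => ?_) ?_) (dvd_mul_of_dvd_left hpow _)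
  · refine hpow.trans ?_
    rw [sq]
    refine mul_dvd_mul (hX _) ?_
    have := hX (F l)
    rwa [hFa, sub_zero] at this
  · rw [pow_add]
    exact mul_dvd_mul_left _ (Finset.dvd_sum fun j _ => dvd_mul_of_dvd_left (ha.dvd i j) _)

/-! ### Strata of jets and their charts -/

section Charts

variable {k : Type*} [Field k] {n p d e : ℕ}

lemma mem_mPow_iff {r : ℕ} {y : Series k d} :
    y ∈ mPow k d r ↔ ∀ o, (PowerSeries.X : PowerSeries k) ^ r ∣ y o := by
  simp only [mPow, Ideal.span_singleton_pow, Ideal.mem_span_singleton, Set.mem_ofPred_eq]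

/-- A simultaneous parametrization `Φ` of the arcs of `V(f)` over the points of a set `S` of jets
by the tails of the coordinates numbered by `O`. -/
structure IsChart (f : Fin p → MvPolynomial (Fin n) k) (S : Set (Jet k n e)) (O : Fin d → Fin n)
    (δ : MvPolynomial (Fin n × Fin (e + 1)) k) (Φ : Jet k n e → Series k d → Series k n) :
    Prop where
  locallyClosed : ∃ E : Set (MvPolynomial (Fin n × Fin (e + 1)) k),
    S = {α | eval α δ ≠ 0 ∧ ∀ P ∈ E, eval α P = 0}
  mem_arcs : ∀ s ∈ S, ∀ y ∈ mPow k d (e + 1), Φ s y ∈ arcs f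
  trunc_eq : ∀ s ∈ S, ∀ y ∈ mPow k d (e + 1), trunc e (Φ s y) = s
  free : ∀ s ∈ S, ∀ y ∈ mPow k d (e + 1), ∀ o, Φ s y (O o) = jetSeries s (O o) + y o
  determined : ∀ a ∈ arcsOver f e S, ∀ b ∈ arcs f, trunc e a = trunc e b → ∀ q,
    (∀ o, PowerSeries.X ^ (q + 1) ∣ b (O o) - a (O o)) → trunc q b = trunc q a
  regular : ∀ j i, ∃ (P : MvPolynomial ((Fin n × Fin (e + 1)) ⊕ (Fin d × ℕ)) k) (N : ℕ),
    ∀ s ∈ S, ∀ y ∈ mPow k d (e + 1), PowerSeries.coeff i (Φ s y j) * eval s δ ^ N =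
      eval (Sum.elim s (coeffs y)) P

lemma isChart_empty (f : Fin p → MvPolynomial (Fin n) k) (O : Fin d → Fin n) :
    IsChart f (∅ : Set (Jet k n e)) O 0 fun _ _ => 0 where
  locallyClosed := ⟨∅, by simp⟩
  mem_arcs := by simp
  trunc_eq := by simp
  free := by simp
  determined := fun a ha => by simp [arcsOver] at ha
  regular := fun _ _ => ⟨0, 0, by simp⟩

/-- The minor of the Jacobian matrix with given rows and columns. -/
noncomputable def minor (f : Fin p → MvPolynomial (Fin n) k) {r : ℕ}
    (RC : (Fin r → Fin p) × (Fin r → Fin n)) : MvPolynomial (Fin n) k :=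
  (jacMinor (f ∘ RC.1) RC.2).det

lemma exists_frame {r : ℕ} (hn : r + d = n) {C : Fin r → Fin n} (hC : Function.Injective C) :
    ∃ σ : Fin r ⊕ Fin d ≃ Fin n, σ ∘ Sum.inl = C := by
  classical
  have hcard : Fintype.card {j // j ∉ Set.range C} = d := by
    rw [Fintype.card_subtype_compl, Fintype.card_fin]
    have : Fintype.card {x // x ∈ Set.range C} = r :=
      (Fintype.card_congr (Equiv.ofInjective C hC).symm).trans (Fintype.card_fin r)
    omega
  let τ : Fin d ≃ {j // j ∉ Set.range C} := (Fintype.equivFinOfCardEq hcard).symm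
  refine ⟨(Equiv.sumCongr (Equiv.ofInjective C hC) τ).trans
    (Equiv.sumCompl fun j => j ∈ Set.range C), ?_⟩
  ext1 i
  simp

lemma aeval_eq_zero_of_mem_arcs {f : Fin p → MvPolynomial (Fin n) k} {a : Series k n}
    (ha : a ∈ arcs f) {g : MvPolynomial (Fin n) k} (hg : g ∈ (Ideal.span (Set.range f)).radical) :
    aeval a g = 0 := by
  obtain ⟨N, hN⟩ := hg
  have hle : Ideal.span (Set.range f) ≤ RingHom.ker (aeval (R := k) a) := by
    rw [Ideal.span_le]
    rintro _ ⟨i, rfl⟩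
    exact ha i
  have := hle hN
  rw [RingHom.mem_ker, map_pow] at this
  exact eq_zero_of_pow_eq_zero this

/-- The jets of arcs at which the first non-vanishing coefficient of a minor, with respect to
the lexicographic order on the pairs of an exponent and a minor, is the one numbered by `t`. -/
def stratum (f : Fin p → MvPolynomial (Fin n) k) (e : ℕ) {r M : ℕ}
    (ν : Fin M ≃ (Fin r → Fin p) × (Fin r → Fin n)) (t : Fin (e + 1) ×ₗ Fin M) :
    Set (Jet k n e) :=
  {α | eval α (jetCoeff e (minor f (ν (ofLex t).2)) (ofLex t).1) ≠ 0 ∧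
    (∀ t' < t, eval α (jetCoeff e (minor f (ν (ofLex t').2)) (ofLex t').1) = 0) ∧
    ∃ a ∈ arcs f, trunc e a = α}

/-- Newton's method parametrizes the solutions of the `r` equations selected by `t`. The deformation
argument shows that over a jet of an arc of X they all lie in X. -/
lemma exists_isChart_stratum [CharZero k] {f : Fin p → MvPolynomial (Fin n) k}
    (hX : IsPureDim f d) {r M : ℕ} (hn : r + d = n)
    (ν : Fin M ≃ (Fin r → Fin p) × (Fin r → Fin n)) (t : Fin (e + 1) ×ₗ Fin M) :
    ∃ O δ Φ, IsChart (d := d) f (stratum f e ν t) O δ Φ := by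
  rcases (stratum f e ν t).eq_empty_or_nonempty with hS | ⟨α₀, hα₀⟩
  · rw [hS]
    exact ⟨_, _, _, isChart_empty f fun i => Fin.cast hn (Fin.natAdd r i)⟩
  set m : ℕ := (ofLex t).1.val with hm
  have hme : m ≤ e := Nat.le_of_lt_succ (ofLex t).1.2
  set RC := ν (ofLex t).2 with hRC
  set F : Fin r → MvPolynomial (Fin n) k := f ∘ RC.1 with hF
  have hC : Function.Injective RC.2 := by
    by_contra hC
    obtain ⟨i, j, hij, hne⟩ := Function.not_injective_iff.1 hC
    have h0 : minor f RC = 0 :=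
      Matrix.det_zero_of_column_eq hne fun l => by simp [jacMinor, hij]
    refine hα₀.1 ?_
    rw [eval_jetCoeff, ← hRC, h0, map_zero, map_zero]
  obtain ⟨σ, hσ⟩ := exists_frame hn hC
  have hFI : ∀ i, F i ∈ (Ideal.span (Set.range f)).radical := fun i =>
    Ideal.le_radical (Ideal.subset_span ⟨_, rfl⟩)
  set δ := jetCoeff e (minor f RC) m with hδ
  -- The lexicographic order compares exponents first, so below `t` lie all coefficients of order
  -- less than `m` of every minor.
  have hminor : ∀ α : Jet k n e,
      (∀ t' < t, eval α (jetCoeff e (minor f (ν (ofLex t').2)) (ofLex t').1) = 0) →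
      ∀ RC' : (Fin r → Fin p) × (Fin r → Fin n),
        PowerSeries.X ^ m ∣ aeval (jetSeries α) (minor f RC') := by
    intro α hα RC'
    rw [PowerSeries.X_pow_dvd_iff]
    intro i hi
    have h := hα (toLex (⟨i, by omega⟩, ν.symm RC'))
      (Prod.Lex.toLex_lt_toLex.2 (Or.inl hi) : toLex (_, _) < toLex ((ofLex t).1, (ofLex t).2))
    rw [eval_jetCoeff] at h
    simpa using h
  -- Conditions that do not mention arcs: all minors have order at least `m`, and the jet solves adj
  -- M · F = 0 to order e+1+m. Together with `δ ≠ 0` they suffice for lifting to solutions of F = 0.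
  let E₀ : Set (MvPolynomial (Fin n × Fin (e + 1)) k) :=
    {P | (∃ t' < t, P = jetCoeff e (minor f (ν (ofLex t').2)) (ofLex t').1) ∨
      ∃ i, ∃ s < e + 1 + m, P = jetCoeff e (∑ l, (jacMinor F RC.2).adjugate i l * F l) s}
  let S₀ : Set (Jet k n e) := {α | eval α δ ≠ 0 ∧ ∀ P ∈ E₀, eval α P = 0}
  have hS₀t : ∀ α ∈ S₀, ∀ t' < t,
      eval α (jetCoeff e (minor f (ν (ofLex t').2)) (ofLex t').1) = 0 :=
    fun α hα t' ht' => hα.2 _ (Or.inl ⟨t', ht', rfl⟩)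
  have hdet : ∀ α ∈ S₀, PowerSeries.X ^ m ∣
      aeval (jetSeries α) (jacMinor F (σ ∘ Sum.inl)).det := by
    intro α hα
    rw [hσ]
    exact hminor α (hS₀t α hα) RC
  have hdetδ : ∀ α : Jet k n e, PowerSeries.coeff m
      (aeval (jetSeries α) (jacMinor F (σ ∘ Sum.inl)).det) = eval α δ := by
    intro α
    rw [hσ, hδ, eval_jetCoeff]
    rfl
  have hadj : ∀ α ∈ S₀, ∀ i j, PowerSeries.X ^ m ∣
      aeval (jetSeries α) (adjJac F (σ ∘ Sum.inl) i j) := by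
    intro α hα i j
    rw [adjJac_eq_det]
    exact hminor α (hS₀t α hα) (RC.1, _)
  have hFS : ∀ α ∈ S₀, ∀ i, PowerSeries.X ^ (e + 1 + m) ∣
      aeval (jetSeries α) (∑ l, (jacMinor F (σ ∘ Sum.inl)).adjugate i l * F l) := by
    intro α hα i
    rw [PowerSeries.X_pow_dvd_iff, hσ]
    intro s hs
    rw [← eval_jetCoeff]
    exact hα.2 _ (Or.inr ⟨i, s, hs, rfl⟩)
  have hadapted : ∀ α ∈ S₀, ∀ b : Series k n, trunc e b = α →
      IsAdapted F (σ ∘ Sum.inl) m b := by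
    intro α hα b hb
    refine IsAdapted.congr hme ⟨?_, hadj α hα⟩ (dvd_jetSeries_sub hb)
    obtain ⟨v, hv⟩ := hdet α hα
    refine ⟨v, ?_, hv⟩
    have h1 := hdetδ α
    rw [hv, PowerSeries.coeff_X_pow_mul', if_pos le_rfl, Nat.sub_self,
      PowerSeries.coeff_zero_eq_constantCoeff] at h1
    rw [PowerSeries.isUnit_iff_constantCoeff, isUnit_iff_ne_zero, h1]
    exact hα.1
  have hsub : stratum f e ν t ⊆ S₀ := by
    rintro α ⟨h1, h2, a, ha, hat⟩
    refine ⟨h1, ?_⟩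
    rintro _ (⟨t', ht', rfl⟩ | ⟨i, s, hs, rfl⟩)
    · exact h2 t' ht'
    · have hjac : IsAdapted F RC.2 m (jetSeries α) := by
        refine ⟨?_, fun i j => ?_⟩
        · obtain ⟨v, hv⟩ := hminor α h2 RC
          refine ⟨v, ?_, hv⟩
          rw [eval_jetCoeff, ← hRC, hv, ← hm, PowerSeries.coeff_X_pow_mul', if_pos le_rfl,
            Nat.sub_self, PowerSeries.coeff_zero_eq_constantCoeff] at h1
          rw [PowerSeries.isUnit_iff_constantCoeff, isUnit_iff_ne_zero]
          exact h1
        · rw [adjJac_eq_det]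
          exact hminor α h2 (RC.1, _)
      have hd := dvd_jetSeries_sub hat
      have := (hjac.congr hme hd).dvd_adjugate_mul hme (fun i => ha _) hd i
      rw [eval_jetCoeff]
      exact PowerSeries.X_pow_dvd_iff.1 this s hs
  have htransfer : ∀ α ∈ S₀, ∀ a ∈ arcs f, trunc e a = α → ∀ b : Series k n, trunc e b = α →
      (∀ i, aeval b (F i) = 0) → b ∈ arcs f := by
    intro α hα a ha hat b hbt hFb i
    exact aeval_eq_zero_of_mem_radical hX hFI hme (hadapted α hα a hat)
      (trunc_eq_iff.1 (hbt.trans hat.symm)) hFb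
      (fun g hg => aeval_eq_zero_of_mem_arcs ha hg) (f i)
      (Ideal.le_radical (Ideal.subset_span ⟨i, rfl⟩))
  -- One test solution of F = 0 over each jet in `S₀`. By `htransfer` the jet lifts to an arc of X
  -- exactly when this solution lies in X, so the coefficients of f(b₀), cleared of denominators,
  -- are the missing equations of the stratum.
  obtain ⟨b₀, hb₀r, hb₀F, hb₀a, -⟩ := exists_regular_solution (Ω := S₀) (u := Subtype.val)
    (fun ω => ω.2.1) hme (a := fun α => jetSeries α.1)
    (coeff_jetSeries_mem _ _ fun i => ⟨X i, 0, by simp⟩)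
    (fun ω => hdet ω.1 ω.2) (fun ω => hdetδ ω.1) (fun ω => hadj ω.1 ω.2) (fun ω => hFS ω.1 ω.2)
    (fun _ _ => 0) (fun _ _ => const_mem_regularFunctions _ _ 0)
  have hb₀t : ∀ ω : S₀, trunc e (b₀ ω) = ω := fun ω => by
    conv_rhs => rw [← trunc_jetSeries ω.1]
    exact trunc_eq_iff.2 (hb₀a ω)
  choose P₀ N₀ hP₀ using fun j i => coeff_aeval_mem _ b₀ hb₀r (f j) i
  have hS : stratum f e ν t = {α | eval α δ ≠ 0 ∧
      ∀ P ∈ E₀ ∪ Set.range fun ji : Fin p × ℕ => P₀ ji.1 ji.2, eval α P = 0} := by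
    ext α
    constructor
    · intro hα
      refine ⟨hα.1, ?_⟩
      rintro P (hP | ⟨⟨j, i⟩, rfl⟩)
      · exact (hsub hα).2 P hP
      · obtain ⟨a, ha, hat⟩ := hα.2.2
        have h1 := hP₀ j i ⟨α, hsub hα⟩
        have h2 := htransfer α (hsub hα) a ha hat (b₀ ⟨α, hsub hα⟩) (hb₀t _) (hb₀F _) j
        simp only [h2, map_zero, zero_mul] at h1
        exact h1.symm
    · rintro ⟨h1, h2⟩
      have hα : α ∈ S₀ := ⟨h1, fun P hP => h2 P (Or.inl hP)⟩
      refine ⟨h1, hS₀t α hα, b₀ ⟨α, hα⟩, fun j => ?_, hb₀t ⟨α, hα⟩⟩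
      ext i
      have h3 := hP₀ j i ⟨α, hα⟩
      rw [h2 _ (Or.inr ⟨(j, i), rfl⟩)] at h3
      rw [map_zero]
      exact (mul_eq_zero.1 h3).resolve_right (pow_ne_zero _ h1)
  obtain ⟨b, hbr, hbF, hba, hbO⟩ := exists_regular_solution
    (Ω := {x : Jet k n e × Series k d // x.1 ∈ stratum f e ν t ∧ x.2 ∈ mPow k d (e + 1)})
    -- Parameters are now pairs (s, y). The renamed `δ` involves only `s`, as required of
    -- denominators in a regular family.
    (u := fun x => Sum.elim x.1.1 (coeffs x.1.2)) (δ := rename Sum.inl δ)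
    (fun ω => by
      rw [eval_rename, Sum.elim_comp_inl]
      exact ω.2.1.1) hme (a := fun x => jetSeries x.1.1)
    (coeff_jetSeries_mem _ _ fun i => ⟨X (Sum.inl i), 0, by simp⟩)
    (fun ω => hdet ω.1.1 (hsub ω.2.1)) (fun ω => by
      rw [eval_rename, Sum.elim_comp_inl]
      exact hdetδ ω.1.1) (fun ω => hadj ω.1.1 (hsub ω.2.1)) (fun ω => hFS ω.1.1 (hsub ω.2.1))
    -- An element of 𝔪^(e+1) is divided by t^(e+1), since the solution lemma multiplies by this
    -- power.
    (fun x o => PowerSeries.mk fun i => PowerSeries.coeff (i + (e + 1)) (x.1.2 o))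
    (fun o i => ⟨X (Sum.inr (o, i + (e + 1))), 0, fun ω => by simp [coeffs]⟩)
  have hbt : ∀ ω, trunc e (b ω) = ω.1.1 := fun ω => by
    conv_rhs => rw [← trunc_jetSeries ω.1.1]
    exact trunc_eq_iff.2 (hba ω)
  classical
  obtain ⟨Φ, hΦ⟩ : ∃ Φ : Jet k n e → Series k d → Series k n,
      ∀ (s) (hs : s ∈ stratum f e ν t) (y) (hy : y ∈ mPow k d (e + 1)),
        Φ s y = b ⟨(s, y), hs, hy⟩ :=
    ⟨fun s y => if h : s ∈ stratum f e ν t ∧ y ∈ mPow k d (e + 1) then b ⟨(s, y), h⟩ else 0,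
      fun s hs y hy => dif_pos ⟨hs, hy⟩⟩
  refine ⟨σ ∘ Sum.inr, δ, Φ, ⟨_, hS⟩, fun s hs y hy => ?_, fun s hs y hy => ?_,
    fun s hs y hy o => ?_, ?_, fun j i => ?_⟩
  · rw [hΦ s hs y hy]
    obtain ⟨a, ha, hat⟩ := hs.2.2
    exact htransfer s (hsub hs) a ha hat _ (hbt _) (hbF _)
  · rw [hΦ s hs y hy]
    exact hbt _
  · rw [hΦ s hs y hy]
    refine (hbO _ o).trans ?_
    congr 1
    ext i
    rw [PowerSeries.coeff_X_pow_mul']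
    split_ifs with hi
    · simp [Nat.sub_add_cancel hi]
    · exact (PowerSeries.X_pow_dvd_iff.1 (mem_mPow_iff.1 hy o) i (by omega)).symm
  · rintro a ⟨ha, haS⟩ b hb hab q hq
    exact trunc_eq_iff.2 ((hadapted _ (hsub haS) a rfl).dvd_sub_of_free hme
      (trunc_eq_iff.1 hab.symm) (fun i => ha _) (fun i => hb _) hq)
  · obtain ⟨P, N, hP⟩ := hbr j i
    refine ⟨P, N, fun s hs y hy => ?_⟩
    have h := hP ⟨(s, y), hs, hy⟩
    simp only [eval_rename, Sum.elim_comp_inl] at h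
    rw [hΦ s hs y hy]
    exact h

end Charts

/-! ### Trivializations of arcs and jets from a chart -/

section Trivializations

variable {k : Type*} [Field k] {n p d e q : ℕ}

lemma IsRegularMap.of_mul_eq {α β ι κ : Type*} {u : α → ι → k} {v : β → κ → k} {g : α → β}
    (h : ∀ j, ∃ P L : MvPolynomial ι k, ∀ x, eval (u x) L ≠ 0 ∧
      v (g x) j * eval (u x) L = eval (u x) P) : IsRegularMap u v g := by
  intro j x₀
  obtain ⟨P, L, hPL⟩ := h j
  exact ⟨P, L, (hPL x₀).1, fun x hx => (eq_div_iff hx).2 (hPL x).2⟩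

lemma isZariskiLocallyClosed_of_eqns {ι : Type*} (δ : MvPolynomial ι k)
    (E : Set (MvPolynomial ι k)) :
    IsZariskiLocallyClosed {x : ι → k | eval x δ ≠ 0 ∧ ∀ P ∈ E, eval x P = 0} := by
  refine ⟨Ideal.span E, Ideal.span {δ}, ?_⟩
  ext x
  simp only [zeroLocus_span, Set.mem_sdiff, Set.mem_ofPred_eq, Set.mem_singleton_iff, forall_eq,
    aeval_eq_eval, ne_eq]
  exact and_comm

/-- The inclusion of the coordinates of jets of lower order. -/
def castIndex (h : e ≤ q) (ji : Fin n × Fin (e + 1)) : Fin n × Fin (q + 1) :=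
  (ji.1, Fin.castLE (by omega) ji.2)

/-- Restriction of a jet to a lower order. -/
def jetRestrict (h : e ≤ q) (z : Jet k n q) : Jet k n e :=
  fun ji => z (castIndex h ji)

/-- The parts of order greater than `e` of the coordinates numbered by `O`. -/
noncomputable def tail (e : ℕ) (O : Fin d → Fin n) (a : Series k n) : Series k d :=
  fun o => PowerSeries.mk fun i => if e < i then PowerSeries.coeff i (a (O o)) else 0

/-- The terms of order greater than `e` of the coordinates of a jet numbered by `O`, with further
terms of order `q + 1`. -/
noncomputable def jetTail (e : ℕ) (O : Fin d → Fin n) (z : Jet k n q) (v : Fin d → k) :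
    Series k d :=
  fun o => PowerSeries.mk fun i =>
    if h : i < q + 1 then (if e < i then z (O o, ⟨i, h⟩) else 0) else if i = q + 1 then v o else 0

lemma mem_mPow_iff_coeff {r : ℕ} {y : Series k d} :
    y ∈ mPow k d r ↔ ∀ o i, i < r → PowerSeries.coeff i (y o) = 0 := by
  simp_rw [mem_mPow_iff, PowerSeries.X_pow_dvd_iff]

lemma tail_mem (O : Fin d → Fin n) (a : Series k n) : tail e O a ∈ mPow k d (e + 1) := by
  rw [mem_mPow_iff_coeff]
  intro o i hi
  rw [tail, PowerSeries.coeff_mk, if_neg (by omega)]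

lemma jetTail_mem (he : e ≤ q) (O : Fin d → Fin n) (z : Jet k n q) (v : Fin d → k) :
    jetTail e O z v ∈ mPow k d (e + 1) := by
  rw [mem_mPow_iff_coeff]
  intro o i hi
  rw [jetTail, PowerSeries.coeff_mk, dif_pos (by omega), if_neg (by omega)]

lemma jetSeries_mem {w : Jet k d q} (hw : w ∈ trunc q '' mPow k d (e + 1)) :
    jetSeries w ∈ mPow k d (e + 1) := by
  obtain ⟨y, hy, rfl⟩ := hw
  rw [mem_mPow_iff_coeff] at hy ⊢
  intro o i hi
  rw [coeff_jetSeries]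
  split_ifs
  · exact hy o i hi
  · rfl

lemma trunc_jetTail_trunc (O : Fin d → Fin n) (a : Series k n) (v : Fin d → k) :
    trunc q (jetTail e O (trunc q a) v) = trunc q (tail e O a) := by
  ext ⟨o, i⟩
  simp only [trunc, jetTail, tail, PowerSeries.coeff_mk]
  rw [dif_pos i.2]

lemma trunc_succ_jetTail_trunc (he : e ≤ q) (O : Fin d → Fin n) (a : Series k n) :
    trunc (q + 1) (jetTail e O (trunc q a) fun o => PowerSeries.coeff (q + 1) (a (O o))) =
      trunc (q + 1) (tail e O a) := by
  ext ⟨o, i, hi⟩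
  simp only [trunc, jetTail, tail, PowerSeries.coeff_mk]
  by_cases h : i < q + 1
  · rw [dif_pos h]
  · obtain rfl : i = q + 1 := by omega
    rw [dif_neg h, if_pos rfl, if_pos (by omega)]

namespace IsChart

variable {f : Fin p → MvPolynomial (Fin n) k} {S : Set (Jet k n e)} {O : Fin d → Fin n}
  {δ : MvPolynomial (Fin n × Fin (e + 1)) k} {Φ : Jet k n e → Series k d → Series k n}

lemma ne_zero (h : IsChart f S O δ Φ) {s : Jet k n e} (hs : s ∈ S) : eval s δ ≠ 0 := by
  obtain ⟨E, rfl⟩ := h.locallyClosed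
  exact hs.1

lemma mem_arcsOver (h : IsChart f S O δ Φ) {s : Jet k n e} (hs : s ∈ S) {y : Series k d}
    (hy : y ∈ mPow k d (e + 1)) : Φ s y ∈ arcsOver f e S :=
  ⟨h.mem_arcs s hs y hy, by rw [h.trunc_eq s hs y hy]; exact hs⟩

lemma tail_apply (h : IsChart f S O δ Φ) {s : Jet k n e} (hs : s ∈ S) {y : Series k d}
    (hy : y ∈ mPow k d (e + 1)) : tail e O (Φ s y) = y := by
  ext o i
  rw [tail, PowerSeries.coeff_mk, h.free s hs y hy, map_add, coeff_jetSeries]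
  split_ifs with h1 h2
  · omega
  · rw [zero_add]
  · exact (mem_mPow_iff_coeff.1 hy o i (by omega)).symm

/-- Lets the chart descend to q-jets: the two arcs share the e-jet `s`, and their free coordinates
differ by `y - y'`. -/
lemma trunc_congr (h : IsChart f S O δ Φ) {s : Jet k n e} (hs : s ∈ S) {y y' : Series k d}
    (hy : y ∈ mPow k d (e + 1)) (hy' : y' ∈ mPow k d (e + 1)) (hyy' : trunc q y = trunc q y') :
    trunc q (Φ s y) = trunc q (Φ s y') := by
  refine h.determined _ (h.mem_arcsOver hs hy') _ (h.mem_arcs s hs y hy)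
    (by rw [h.trunc_eq s hs y hy, h.trunc_eq s hs y' hy']) q fun o => ?_
  rw [h.free s hs y hy, h.free s hs y' hy', add_sub_add_left_eq_sub]
  exact trunc_eq_iff.1 hyy' o

/-- Both arcs have the same e-jet and the same free coordinates, so they agree to every order. -/
lemma apply_tail (h : IsChart f S O δ Φ) {a : Series k n} (ha : a ∈ arcsOver f e S) :
    Φ (trunc e a) (tail e O a) = a := by
  have hΦ := h.trunc_eq _ ha.2 _ (tail_mem O a)
  have hfree : ∀ o, Φ (trunc e a) (tail e O a) (O o) = a (O o) := by
    intro o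
    rw [h.free _ ha.2 _ (tail_mem O a)]
    ext i
    rw [map_add, coeff_jetSeries, tail, PowerSeries.coeff_mk]
    by_cases hi : i < e + 1
    · rw [dif_pos hi, if_neg (by omega), add_zero]; rfl
    · rw [dif_neg hi, if_pos (by omega), zero_add]
  refine funext fun j => eq_of_forall_X_pow_dvd_sub fun m => ?_
  refine (pow_dvd_pow _ m.le_succ).trans (trunc_eq_iff.1 (h.determined a ha _
    (h.mem_arcs _ ha.2 _ (tail_mem O a)) hΦ.symm m fun o => ?_) j)
  simp [hfree]

lemma trunc_apply_of_trunc_eq (h : IsChart f S O δ Φ) {a : Series k n} (ha : a ∈ arcsOver f e S)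
    {y : Series k d} (hy : y ∈ mPow k d (e + 1)) (hya : trunc q y = trunc q (tail e O a)) :
    trunc q (Φ (trunc e a) y) = trunc q a := by
  rw [h.trunc_congr ha.2 hy (tail_mem O a) hya, h.apply_tail ha]

lemma regular_comp (h : IsChart f S O δ Φ) {ι : Type*}
    (sp : Fin n × Fin (e + 1) → MvPolynomial ι k) (yp : Fin d × ℕ → MvPolynomial ι k)
    (j : Fin n) (i : ℕ) :
    ∃ P L : MvPolynomial ι k, ∀ (v : ι → k), ∀ s ∈ S, ∀ y ∈ mPow k d (e + 1),
      (∀ t, s t = eval v (sp t)) → (∀ t, coeffs y t = eval v (yp t)) →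
      eval v L ≠ 0 ∧ PowerSeries.coeff i (Φ s y j) * eval v L = eval v P := by
  obtain ⟨P, N, hP⟩ := h.regular j i
  refine ⟨bind₁ (Sum.elim sp yp) P, bind₁ sp δ ^ N, fun v s hs y hy hsp hyp => ?_⟩
  have h1 : eval v (bind₁ sp δ) = eval s δ := by
    rw [← aeval_eq_eval, aeval_bind₁]
    simp_rw [aeval_eq_eval, ← hsp]
  have h2 : eval v (bind₁ (Sum.elim sp yp) P) = eval (Sum.elim s (coeffs y)) P := by
    rw [← aeval_eq_eval, aeval_bind₁, aeval_eq_eval]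
    congr 2
    ext t
    rcases t with t | t
    · exact (hsp t).symm
    · exact (hyp t).symm
  rw [map_pow, h1, h2]
  exact ⟨pow_ne_zero _ (h.ne_zero hs), hP s hs y hy⟩

/-- The trivialization of the truncation map on arcs. -/
noncomputable def arcEquiv (h : IsChart f S O δ Φ) :
    ↥(arcsOver f e S) ≃ ↥S × ↥(mPow k d (e + 1)) where
  toFun a := (⟨trunc e a.1, a.2.2⟩, ⟨tail e O a.1, tail_mem O a.1⟩)
  invFun x := ⟨Φ x.1 x.2, h.mem_arcsOver x.1.2 x.2.2⟩
  left_inv a := Subtype.ext (h.apply_tail a.2)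
  right_inv x := Prod.ext (Subtype.ext (h.trunc_eq _ x.1.2 _ x.2.2))
    (Subtype.ext (h.tail_apply x.1.2 x.2.2))

lemma isTextile_arcEquiv (h : IsChart f S O δ Φ) :
    IsTextile (seriesCoord _) (prodCoord Subtype.val (seriesCoord _)) h.arcEquiv := by
  rintro (⟨j, i⟩ | ⟨o, i⟩)
  · exact ⟨X (j, i), fun a => by rw [eval_X]; rfl⟩
  · refine ⟨if e < i then X (O o, i) else 0, fun a => ?_⟩
    change PowerSeries.coeff i (tail e O a.1 o) = _
    rw [tail, PowerSeries.coeff_mk]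
    split_ifs
    · rw [eval_X]; rfl
    · rw [map_zero]

lemma isRegularFamily_arcEquiv_symm (h : IsChart f S O δ Φ) :
    IsRegularFamily Subtype.val (seriesCoord _) (seriesCoord _) h.arcEquiv.symm := by
  rintro ⟨j, i⟩ s₀
  obtain ⟨P, N, hP⟩ := h.regular j i
  refine ⟨P, δ ^ N, ?_, fun s y hs => ?_⟩
  · rw [map_pow]
    exact pow_ne_zero _ (h.ne_zero s₀.2)
  · rw [eq_div_iff hs, map_pow]
    exact hP s.1 s.2 y.1 y.2

/-- The trivialization of the truncation map on jets of order `q`. -/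
noncomputable def jetEquiv (h : IsChart f S O δ Φ) (he : e ≤ q) :
    ↥(trunc q '' arcsOver f e S) ≃ ↥S × ↥(trunc q '' mPow k d (e + 1)) where
  toFun z := (⟨jetRestrict he z.1, by
      obtain ⟨_, a, ha, rfl⟩ := z
      exact ha.2⟩,
    -- The coefficient of order `q + 1` is set to 0; truncation discards it.
    ⟨trunc q (jetTail e O z.1 0), _, jetTail_mem he O z.1 0, rfl⟩)
  invFun x := ⟨trunc q (Φ x.1 (jetSeries x.2.1)), _,
    h.mem_arcsOver x.1.2 (jetSeries_mem x.2.2), rfl⟩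
  left_inv := by
    rintro ⟨_, a, ha, rfl⟩
    refine Subtype.ext (h.trunc_apply_of_trunc_eq ha (jetSeries_mem ?_) ?_)
    · exact ⟨_, jetTail_mem he O _ 0, rfl⟩
    · exact (trunc_jetSeries _).trans (trunc_jetTail_trunc O a 0)
  right_inv x := by
    refine Prod.ext (Subtype.ext (h.trunc_eq _ x.1.2 _ (jetSeries_mem x.2.2))) (Subtype.ext ?_)
    change trunc q (jetTail e O (trunc q (Φ x.1 (jetSeries x.2.1))) 0) = _
    rw [trunc_jetTail_trunc, h.tail_apply x.1.2 (jetSeries_mem x.2.2), trunc_jetSeries]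

lemma jetEquiv_trunc (h : IsChart f S O δ Φ) (he : e ≤ q) (a : ↥(arcsOver f e S)) :
    h.jetEquiv he ⟨trunc q (a : Series k n), a, a.2, rfl⟩ =
      ((h.arcEquiv a).1, ⟨trunc q ((h.arcEquiv a).2 : Series k d), (h.arcEquiv a).2,
        (h.arcEquiv a).2.2, rfl⟩) :=
  Prod.ext rfl (Subtype.ext (trunc_jetTail_trunc O a.1 0))

lemma isRegularMap_jetEquiv (h : IsChart f S O δ Φ) (he : e ≤ q) :
    IsRegularMap Subtype.val (prodCoord Subtype.val Subtype.val) (h.jetEquiv he) := by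
  refine IsRegularMap.of_mul_eq ?_
  rintro (⟨j, i⟩ | ⟨o, i⟩)
  · refine ⟨X (castIndex he (j, i)), 1, fun z => ⟨by simp, ?_⟩⟩
    rw [map_one, mul_one, eval_X]
    rfl
  · refine ⟨if e < i then X (O o, i) else 0, 1, fun z => ⟨by simp, ?_⟩⟩
    rw [map_one, mul_one]
    refine (PowerSeries.coeff_mk (R := k) _ _).trans ?_
    rw [dif_pos i.2]
    split_ifs
    · rw [eval_X]
    · rw [map_zero]

lemma isRegularMap_jetEquiv_symm (h : IsChart f S O δ Φ) (he : e ≤ q) :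
    IsRegularMap (prodCoord Subtype.val Subtype.val) Subtype.val (h.jetEquiv he).symm := by
  refine IsRegularMap.of_mul_eq fun ⟨j, i⟩ => ?_
  obtain ⟨P, L, hPL⟩ := h.regular_comp (ι := (Fin n × Fin (e + 1)) ⊕ (Fin d × Fin (q + 1)))
    (fun t => X (Sum.inl t)) (fun t => if h : t.2 < q + 1 then X (Sum.inr (t.1, ⟨t.2, h⟩)) else 0)
    j i
  refine ⟨P, L, fun x => hPL _ x.1.1 x.1.2 (jetSeries x.2.1) (jetSeries_mem x.2.2)
    (fun t => by rw [eval_X]; rfl) fun t => ?_⟩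
  rw [coeffs, coeff_jetSeries]
  split_ifs
  · rw [eval_X]; rfl
  · rw [map_zero]

lemma isZariskiLocallyClosed (h : IsChart f S O δ Φ) : IsZariskiLocallyClosed S := by
  obtain ⟨E, hE⟩ := h.locallyClosed
  rw [hE]
  exact isZariskiLocallyClosed_of_eqns δ E

lemma eval_rename_castLE (he : e ≤ q) (z : Jet k n q)
    (P : MvPolynomial (Fin n × Fin (e + 1)) k) :
    eval z (rename (castIndex he) P) =
      eval (jetRestrict he z) P := by
  rw [eval_rename]
  rfl

lemma coeffs_jetTail {ι : Type*} {x : ι → k} {z : Jet k n q} {v : Fin d → k}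
    {zp : Fin n × Fin (q + 1) → MvPolynomial ι k} {vp : Fin d → MvPolynomial ι k}
    (hz : ∀ t, z t = eval x (zp t)) (hv : ∀ o, v o = eval x (vp o)) (t : Fin d × ℕ) :
    coeffs (jetTail e O z v) t = eval x (if h : t.2 < q + 1 then
      (if e < t.2 then zp (O t.1, ⟨t.2, h⟩) else 0) else if t.2 = q + 1 then vp t.1 else 0) := by
  rw [coeffs, jetTail, PowerSeries.coeff_mk]
  split_ifs
  exacts [hz _, (map_zero _).symm, hv _, (map_zero _).symm]

/-- A q-jet comes from an arc over `S` exactly when its e-jet is in `S` and it is the q-jet of Φ at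
its own e-jet and free tail. Cleared of denominators, the latter is a system of polynomial
equations. -/
lemma isZariskiLocallyClosed_image_trunc (h : IsChart f S O δ Φ) (he : e ≤ q) :
    IsZariskiLocallyClosed (trunc q '' arcsOver f e S) := by
  obtain ⟨E, hE⟩ := h.locallyClosed
  choose P L hPL using fun j i => h.regular_comp
    (fun t => X (castIndex he t))
    (fun t => if h : t.2 < q + 1 then
      (if e < t.2 then (X (O t.1, ⟨t.2, h⟩) : MvPolynomial (Fin n × Fin (q + 1)) k) else 0)
      else if t.2 = q + 1 then 0 else 0) j i
  let ρ : MvPolynomial (Fin n × Fin (e + 1)) k →ₐ[k] MvPolynomial (Fin n × Fin (q + 1)) k :=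
    rename (castIndex he)
  have hPL' : ∀ j i (z : Jet k n q), jetRestrict he z ∈ S → eval z (L j i) ≠ 0 ∧
      PowerSeries.coeff i (Φ (jetRestrict he z) (jetTail e O z 0) j) * eval z (L j i) =
        eval z (P j i) := by
    intro j i z hz
    exact hPL j i z _ hz _ (jetTail_mem he O z 0) (fun t => by rw [eval_X]; rfl)
      (coeffs_jetTail (vp := fun _ => 0) (fun t => by rw [eval_X]) fun o => by
        rw [map_zero]; rfl)
  convert isZariskiLocallyClosed_of_eqns (ρ δ) (ρ '' E ∪
    Set.range fun ji : Fin n × Fin (q + 1) => X ji * L ji.1 ji.2 - P ji.1 ji.2) using 1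
  ext z
  have hzS : jetRestrict he z ∈ S ↔ eval z (ρ δ) ≠ 0 ∧ ∀ P ∈ ρ '' E, eval z P = 0 := by
    rw [hE, Set.forall_mem_image]
    simp only [ρ, eval_rename_castLE]
    rfl
  rw [Set.mem_ofPred_eq, Set.union_def]
  constructor
  · rintro ⟨a, ha, rfl⟩
    have hS : jetRestrict he (trunc q a) ∈ S := ha.2
    refine ⟨(hzS.1 hS).1, ?_⟩
    rintro Q (hQ | ⟨⟨j, i⟩, rfl⟩)
    · exact (hzS.1 hS).2 Q hQ
    · have h1 := (hPL' j i _ hS).2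
      have h2 : trunc q (Φ (jetRestrict he (trunc q a)) (jetTail e O (trunc q a) 0)) = trunc q a :=
        h.trunc_apply_of_trunc_eq ha (jetTail_mem he O _ 0) (trunc_jetTail_trunc O a 0)
      rw [map_sub, map_mul, eval_X, ← h1, sub_eq_zero]
      congr 1
      exact (congr_fun h2 (j, i)).symm
  · rintro ⟨h1, h2⟩
    have hS : jetRestrict he z ∈ S := hzS.2 ⟨h1, fun P hP => h2 P (Or.inl hP)⟩
    refine ⟨_, h.mem_arcsOver hS (jetTail_mem he O z 0), ?_⟩
    ext ⟨j, i⟩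
    have h3 := h2 _ (Or.inr ⟨(j, i), rfl⟩)
    obtain ⟨h4, h5⟩ := hPL' j i z hS
    rw [map_sub, map_mul, eval_X, ← h5, sub_eq_zero] at h3
    exact (mul_right_cancel₀ h4 h3).symm

lemma image_trunc_inter (he : e ≤ q) :
    (trunc (q + 1) '' arcs f) ∩ jetTrunc q ⁻¹' (trunc q '' arcsOver f e S) =
      trunc (q + 1) '' arcsOver f e S := by
  ext x
  constructor
  · rintro ⟨⟨a, ha, rfl⟩, b, hb, hba⟩
    refine ⟨a, ⟨ha, ?_⟩, rfl⟩
    have : jetRestrict he (trunc q b) = jetRestrict he (trunc q a) := congr_arg _ hba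
    exact (show trunc e b = trunc e a from this) ▸ hb.2
  · rintro ⟨a, ha, rfl⟩
    exact ⟨⟨a, ha.1, rfl⟩, a, ha, rfl⟩

/-- The trivialization of the truncation map from jets of order `q + 1` to jets of order `q`. -/
noncomputable def jetTruncEquiv (h : IsChart f S O δ Φ) (he : e ≤ q) :
    ↥((trunc (q + 1) '' arcs f) ∩ jetTrunc q ⁻¹' (trunc q '' arcsOver f e S)) ≃
      ↥(trunc q '' arcsOver f e S) × (Fin d → k) where
  -- The fibre coordinates are the coefficients of order `q + 1` of the `d` free components.
  toFun x := (⟨jetTrunc q x.1, x.2.2⟩, fun o => x.1 (O o, Fin.last (q + 1)))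
  invFun x := ⟨trunc (q + 1) (Φ (jetRestrict he x.1.1) (jetTail e O x.1.1 x.2)), by
    rw [image_trunc_inter he]
    refine ⟨_, h.mem_arcsOver ?_ (jetTail_mem he O _ _), rfl⟩
    obtain ⟨⟨_, a, ha, rfl⟩, v⟩ := x
    exact ha.2⟩
  left_inv := by
    rintro ⟨x, hx⟩
    have hx' := hx
    rw [image_trunc_inter he] at hx'
    obtain ⟨a, ha, rfl⟩ := hx'
    exact Subtype.ext (h.trunc_apply_of_trunc_eq ha (jetTail_mem he O _ _)
      (trunc_succ_jetTail_trunc he O a))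
  right_inv := by
    rintro ⟨⟨_, a, ha, rfl⟩, v⟩
    refine Prod.ext (Subtype.ext ?_) (funext fun o => ?_)
    · exact h.trunc_apply_of_trunc_eq ha (jetTail_mem he O _ v) (trunc_jetTail_trunc O a v)
    · have h1 := h.free (trunc e a) ha.2 _ (jetTail_mem he O (trunc q a) v) o
      have h2 := congr_arg (PowerSeries.coeff (q + 1)) h1
      rw [map_add, coeff_jetSeries, dif_neg (by omega), zero_add, jetTail, PowerSeries.coeff_mk,
        dif_neg (lt_irrefl _), if_pos rfl] at h2
      exact h2

lemma isRegularMap_jetTruncEquiv (h : IsChart f S O δ Φ) (he : e ≤ q) :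
    IsRegularMap Subtype.val (prodCoord Subtype.val id) (h.jetTruncEquiv he) := by
  refine IsRegularMap.of_mul_eq ?_
  rintro (⟨j, i⟩ | o)
  · refine ⟨X (j, i.castSucc), 1, fun z => ⟨by simp, ?_⟩⟩
    rw [map_one, mul_one, eval_X]
    rfl
  · refine ⟨X (O o, Fin.last (q + 1)), 1, fun z => ⟨by simp, ?_⟩⟩
    rw [map_one, mul_one, eval_X]
    rfl

lemma isRegularMap_jetTruncEquiv_symm (h : IsChart f S O δ Φ) (he : e ≤ q) :
    IsRegularMap (prodCoord Subtype.val id) Subtype.val (h.jetTruncEquiv he).symm := by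
  refine IsRegularMap.of_mul_eq fun ⟨j, i⟩ => ?_
  obtain ⟨P, L, hPL⟩ := h.regular_comp (ι := (Fin n × Fin (q + 1)) ⊕ Fin d)
    (fun t => X (Sum.inl (castIndex he t)))
    (fun t => if h : t.2 < q + 1 then
      (if e < t.2 then X (Sum.inl (O t.1, ⟨t.2, h⟩)) else 0)
      else if t.2 = q + 1 then X (Sum.inr t.1) else 0) j i
  refine ⟨P, L, fun x => hPL _ _ ?_ _ (jetTail_mem he O x.1.1 x.2) (fun t => by rw [eval_X]; rfl)
    (coeffs_jetTail (zp := fun t => X (Sum.inl t)) (vp := fun t => X (Sum.inr t))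
      (fun t => by rw [eval_X]; rfl) fun o => by rw [eval_X]; rfl)⟩
  obtain ⟨⟨_, a, ha, rfl⟩, v⟩ := x
  exact ha.2

end IsChart

end Trivializations

/-! ### The strata partition the jets of 𝓐_e(X) -/

section Strata

variable {k : Type*} [Field k] {n p d e : ℕ}

/-- An arc makes the ideal proper, so it has a minimal prime, whose quotient has dimension `d` and
at most `n`. -/
lemma le_of_isPureDim {f : Fin p → MvPolynomial (Fin n) k} (hX : IsPureDim f d) {a : Series k n}
    (ha : a ∈ arcs f) : d ≤ n := by
  have hne : Ideal.span (Set.range f) ≠ ⊤ := by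
    intro h
    have := aeval_eq_zero_of_mem_arcs ha (g := 1) (Ideal.le_radical (by rw [h]; trivial))
    rw [map_one] at this
    exact one_ne_zero this
  obtain ⟨P, hP⟩ := Ideal.nonempty_minimalPrimes hne
  have h := ringKrullDim_quotient_le P
  rw [hX P hP] at h
  simpa using h

lemma stratum_disjoint {f : Fin p → MvPolynomial (Fin n) k} {r M : ℕ}
    {ν : Fin M ≃ (Fin r → Fin p) × (Fin r → Fin n)} {t t' : Fin (e + 1) ×ₗ Fin M} (h : t ≠ t') :
    Disjoint (stratum f e ν t) (stratum f e ν t') := by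
  rw [Set.disjoint_left]
  intro α hα hα'
  rcases lt_or_gt_of_ne h with h | h
  · exact hα.1 (hα'.2.1 t h)
  · exact hα'.1 (hα.2.1 t' h)

/-- The generators `f i` vanish on arcs, so order at most `e` means that some minor has a non-zero
coefficient of order at most `e`, which is visible on the e-jet; the least such pair names the
stratum. -/
lemma exists_mem_stratum_iff {f : Fin p → MvPolynomial (Fin n) k} {M : ℕ}
    (ν : Fin M ≃ (Fin (n - d) → Fin p) × (Fin (n - d) → Fin n)) {a : Series k n}
    (ha : a ∈ arcs f) :
    (∃ t, trunc e a ∈ stratum f e ν t) ↔ ordIdeal (singIdeal f d) a ≤ (e : ℕ∞) := by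
  constructor
  · rintro ⟨t, ht⟩
    have h1 := ht.1
    have hi : ((ofLex t).1 : ℕ) ≤ e := Nat.le_of_lt_succ (ofLex t).1.2
    rw [eval_jetCoeff_of_trunc _ hi rfl] at h1
    refine (iInf₂_le (minor f (ν (ofLex t).2)) ?_).trans
      ((PowerSeries.order_le _ h1).trans (by exact_mod_cast hi))
    exact Ideal.subset_span (Or.inr ⟨_, _, rfl⟩)
  · intro h
    by_contra hS
    have h0 : ∀ t : Fin (e + 1) ×ₗ Fin M,
        eval (trunc e a) (jetCoeff e (minor f (ν (ofLex t).2)) (ofLex t).1) = 0 := by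
      by_contra! hne
      have hwf : WellFounded ((· < ·) : (Fin (e + 1) ×ₗ Fin M) → _ → Prop) := wellFounded_lt
      obtain ⟨t, ht, hmin⟩ := hwf.has_min {t | eval (trunc e a)
        (jetCoeff e (minor f (ν (ofLex t).2)) (ofLex t).1) ≠ 0} hne
      exact hS ⟨t, ht, fun t' ht' => not_not.1 fun hc => hmin t' hc ht', a, ha, rfl⟩
    have hle : singIdeal f d ≤ (Ideal.span {(PowerSeries.X : PowerSeries k) ^ (e + 1)}).comap
        (aeval (R := k) a) := by
      rw [singIdeal, Ideal.span_le]
      rintro g (⟨i, rfl⟩ | ⟨R, C, rfl⟩)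
      · rw [SetLike.mem_coe, Ideal.mem_comap, ha i]
        exact zero_mem _
      · rw [SetLike.mem_coe, Ideal.mem_comap, Ideal.mem_span_singleton, PowerSeries.X_pow_dvd_iff]
        intro i hi
        have := h0 (toLex (⟨i, hi⟩, ν.symm (R, C)))
        rw [eval_jetCoeff_of_trunc _ (Nat.le_of_lt_succ (Fin.is_lt _)) rfl] at this
        simp only [ofLex_toLex, Equiv.apply_symm_apply] at this
        exact this
    have : ((e + 1 : ℕ) : ℕ∞) ≤ ordIdeal (singIdeal f d) a := by
      refine le_iInf₂ fun g hg => PowerSeries.nat_le_order _ _ fun i hi => ?_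
      exact PowerSeries.X_pow_dvd_iff.1 (Ideal.mem_span_singleton.1 (hle hg)) i hi
    have h2 := this.trans h
    rw [Nat.cast_le] at h2
    omega

end Strata

end ArcSpace

/-! ### The main theorem -/

open ArcSpace
theorem mainTheorem5 {k : Type*} [Field k] [CharZero k] {n p d : ℕ}
    (f : Fin p → MvPolynomial (Fin n) k) (hX : IsPureDim f d) (e : ℕ) :
    (∃ (N : ℕ) (S : Fin N → Set (Jet k n e)),
      (⋃ i, S i) = trunc e '' arcsOrdLE f d e ∧ Pairwise (Function.onFun Disjoint S) ∧
      ∀ i, IsZariskiLocallyClosed (S i) ∧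
        ∃ φ : ↥(arcsOver f e (S i)) ≃ ↥(S i) × ↥(mPow k d (e + 1)),
          -- `φ` commutes with the projections to `S i`
          (∀ a, ((φ a).1 : Jet k n e) = trunc e (a : Series k n)) ∧
          -- `φ` is textile, and so is its inverse, as a regular family over `S i`
          IsTextile (seriesCoord _) (prodCoord Subtype.val (seriesCoord _)) φ ∧
          IsRegularFamily Subtype.val (seriesCoord _) (seriesCoord _) φ.symm ∧
          -- `φ` induces isomorphisms of the truncations to every order `q ≥ e`
          ∀ q, e ≤ q →
            ∃ φq : ↥(trunc q '' arcsOver f e (S i)) ≃ ↥(S i) × ↥(trunc q '' mPow k d (e + 1)),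
              (∀ a : ↥(arcsOver f e (S i)), φq ⟨trunc q (a : Series k n), a, a.2, rfl⟩ =
                ((φ a).1, ⟨trunc q ((φ a).2 : Series k d), (φ a).2, (φ a).2.2, rfl⟩)) ∧
              IsRegularMap Subtype.val (prodCoord Subtype.val Subtype.val) φq ∧
              IsRegularMap (prodCoord Subtype.val Subtype.val) Subtype.val φq.symm) ∧
    -- the induced statement on jets
    ∀ q, e ≤ q →
      IsPiecewiseTrivial (trunc (q + 1) '' arcs f) (jetTrunc q) (trunc q '' arcsOrdLE f d e) d := by
  -- Without arcs `d ≤ n` may fail, but then every set is empty and the empty partition works.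
  rcases (arcs f).eq_empty_or_nonempty with hf | ⟨a₀, ha₀⟩
  · have hf' : arcsOrdLE f d e = ∅ := by
      ext a
      simp [arcsOrdLE, hf]
    refine ⟨⟨0, Fin.elim0, by simp [hf'], fun i => i.elim0, fun i => i.elim0⟩, fun q _ =>
      ⟨0, Fin.elim0, by simp [hf'], fun i => i.elim0, fun i => i.elim0⟩⟩
  have hn : n - d + d = n := Nat.sub_add_cancel (le_of_isPureDim hX ha₀)
  let ν := (Fintype.equivFin ((Fin (n - d) → Fin p) × (Fin (n - d) → Fin n))).symm
  let τ := (Finite.equivFin (Fin (e + 1) ×ₗ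
    Fin (Fintype.card ((Fin (n - d) → Fin p) × (Fin (n - d) → Fin n))))).symm
  let S := fun i => stratum f e ν (τ i)
  have hS : ∀ a ∈ arcs f, (∃ i, trunc e a ∈ S i) ↔ ordIdeal (singIdeal f d) a ≤ (e : ℕ∞) :=
    fun a ha => τ.surjective.exists.symm.trans (exists_mem_stratum_iff ν ha)
  have hdisj : Pairwise (Function.onFun Disjoint S) := fun i j hij =>
    stratum_disjoint (τ.injective.ne hij)
  have hunion : arcsOrdLE f d e = ⋃ i, arcsOver f e (S i) := by
    ext a
    rw [Set.mem_iUnion]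
    constructor
    · rintro ⟨ha, h⟩
      obtain ⟨i, hi⟩ := (hS a ha).2 h
      exact ⟨i, ha, hi⟩
    · rintro ⟨i, ha, hi⟩
      exact ⟨ha, (hS a ha).1 ⟨i, hi⟩⟩
  have himage : ∀ i, trunc e '' arcsOver f e (S i) = S i := by
    intro i
    ext α
    constructor
    · rintro ⟨a, ha, rfl⟩
      exact ha.2
    · intro hα
      obtain ⟨a, ha, rfl⟩ := hα.2.2
      exact ⟨a, ⟨ha, hα⟩, rfl⟩
  choose O δ Φ h using fun i => exists_isChart_stratum hX hn ν (τ i)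
  refine ⟨⟨_, S, ?_, hdisj, fun i => ⟨(h i).isZariskiLocallyClosed, (h i).arcEquiv, fun _ => rfl,
    (h i).isTextile_arcEquiv, (h i).isRegularFamily_arcEquiv_symm, fun q hq => ⟨(h i).jetEquiv hq,
      (h i).jetEquiv_trunc hq, (h i).isRegularMap_jetEquiv hq,
      -- For jets of order `q` the pieces are the q-jets of arcs over the strata; they are disjoint
      -- because their e-jets are.
      (h i).isRegularMap_jetEquiv_symm hq⟩⟩⟩, fun q hq => ⟨_,
      fun i => trunc q '' arcsOver f e (S i),
      ?_, fun i j hij => ?_, fun i => ⟨(h i).isZariskiLocallyClosed_image_trunc hq, ?_,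
        (h i).jetTruncEquiv hq, fun _ => rfl, (h i).isRegularMap_jetTruncEquiv hq,
        (h i).isRegularMap_jetTruncEquiv_symm hq⟩⟩⟩
  · rw [hunion, Set.image_iUnion]
    exact Set.iUnion_congr fun i => (himage i).symm
  · rw [hunion, Set.image_iUnion]
  · rw [Function.onFun, Set.disjoint_left]
    rintro _ ⟨a, ha, rfl⟩ ⟨b, hb, hba⟩
    have hab : trunc e b = trunc e a := congr_arg (jetRestrict hq) hba
    exact Set.disjoint_left.1 (hdisj hij) ha.2 (hab ▸ hb.2)
  · rw [IsChart.image_trunc_inter hq]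
    exact (h i).isZariskiLocallyClosed_image_trunc (hq.trans q.le_succ)
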